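/- Let $K$ be an algebraically closed field of arbitrary characteristic. A plane algebroid curve $C:\{f=0\}$ is the ideal generated in $K[[x,y]]$ by a nonzero power series $f$ without constant term; its multiplicity is $m(C)=\operatorname{ord} f$. It is reduced if $f$ has no multiple factors, and it is a branch if $f$ is irreducible; a branch is smooth if $m(C)=1$ and singular if $m(C)>1$. For $C:\{f=0\}$ and $D:\{g=0\}$ put $(C,D)_0=(f,g)_0=\dim_K K[[x,y]]/(f,g)\in\mathbb N\cup\{\infty\}$. The semigroup of a branch $C:\{f=0\}$ is $\Gamma(C)=\{(f,g)_0 : g\in K[[x,y]],\ f\nmid g\}$. Its minimal system of generators $v_0,\dots,v_g$ is defined by $v_0=\min(\Gamma(C)\setminus\{0\})$, $v_k=\min\bigl(\Gamma(C)\setminus(\mathbb N v_0+\cdots+\mathbb N v_{k-1})\bigr)$ for $1\le k\le g$, and $\Gamma(C)=\mathbb N v_0+\cdots+\mathbb N v_g$. Two reduced curves $C:\{f=0\}$ and $D:\{g=0\}$ are equisingular if there are factorizations $f=f_1\cdots f_r$ and $g=g_1\cdots g_r$ into the same number of irreducible factors such that the branches $C_i:\{f_i=0\}$ and $D_i:\{g_i=0\}$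 satisfy $\Gamma(C_i)=\Gamma(D_i)$ for all $i$ and $(C_i,C_j)_0=(D_i,D_j)_0$ for all $i,j$. For branches $C,D$ let $d(C,D)=\frac{(C,D)_0}{m(C)m(D)}\in[0,\infty]$; for reduced curves $C,D$ with irreducible components $C_i$, $D_j$ let $d(C,D)=\inf_{i,j}d(C_i,D_j)$. The contact exponent of a reduced curve $C$ is $d(C)=\sup\{d(C,W) : W \text{ a smooth branch}\}\in[0,\infty]$. Then: 1. The contact exponent is an equisingularity invariant: if $C$ and $D$ are equisingular reduced curves, then $d(C)=d(D)$. 2. If $C$ is a singular branch, then $\Gamma(C)$ has a minimal system of generators $v_0,\dots,v_g$ with $g\ge 1$, and $d(C)=\dfrac{v_1}{v_0}$. 3. If $C$ is a smooth branch, then $d(C)=+\infty$. -/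

import Mathlib

open scoped ENNReal

noncomputable section

namespace PlaneCurve

variable {K : Type*} [Field K]

/-- The ring `K[[x,y]]` of formal power series in two variables. -/
abbrev PS (K : Type*) [Field K] : Type _ := MvPowerSeries (Fin 2) K

/-- The intersection number `(f,g)₀ = dim_K K[[x,y]]/(f,g)`, with value `⊤` if the dimension is
infinite. -/
def intersectionNumber (f g : PS K) : ℕ∞ :=
  Cardinal.toENat (Module.rank K (PS K ⧸ Ideal.span ({f, g} : Set (PS K))))

/-- `f` defines a plane algebroid curve `{f = 0}`: it is nonzero without constant term. -/
def IsCurve (f : PS K) : Prop := f ≠ 0 ∧ MvPowerSeries.constantCoeff f = 0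

/-- The curve `{f = 0}` is reduced: `f` has no multiple factors. -/
def IsReducedCurve (f : PS K) : Prop := IsCurve f ∧ Squarefree f

/-- The curve `{f = 0}` is a branch, i.e. an irreducible curve. -/
def IsBranch (f : PS K) : Prop := Irreducible f

/-- The multiplicity `m(C)` of the curve `C : {f = 0}` is the order of the power series `f`, the
least total degree of a monomial of `f`. -/
def multiplicity (f : PS K) : ℕ∞ := MvPowerSeries.order f

/-- A smooth branch is a branch of multiplicity one. -/
def IsSmoothBranch (f : PS K) : Prop := IsBranch f ∧ multiplicity f = 1

/-- A singular branch is a branch of multiplicity greater than one. -/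
def IsSingularBranch (f : PS K) : Prop := IsBranch f ∧ 1 < multiplicity f

/-- The semigroup `Γ(C)` of a branch `C : {f = 0}`: the set of intersection numbers `(f,g)₀`, where
`g` runs over the power series that are not divisible by `f`. -/
def semigroup (f : PS K) : Set ℕ :=
  {n | ∃ g : PS K, ¬ f ∣ g ∧ intersectionNumber f g = (n : ℕ∞)}

/-- `v 0, …, v n` is the minimal system of generators of `S ⊆ ℕ`: `v 0 = min (S \ {0})`,
`v k = min (S \ (ℕ v 0 + ⋯ + ℕ v (k-1)))` for `1 ≤ k ≤ n`, and `S = ℕ v 0 + ⋯ + ℕ v n`. -/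
structure IsMinimalGenerators (S : Set ℕ) {n : ℕ} (v : Fin (n + 1) → ℕ) : Prop where
  zero : IsLeast (S \ {0}) (v 0)
  next : ∀ k : Fin (n + 1), k ≠ 0 →
    IsLeast (S \ (AddSubmonoid.closure (v '' {i | i < k}) : Set ℕ)) (v k)
  generate : S = (AddSubmonoid.closure (Set.range v) : Set ℕ)

/-- Equisingularity of the curves `{f = 0}` and `{g = 0}`: there are factorizations
`f = f₁ ⋯ f_r`, `g = g₁ ⋯ g_r` into the same number of irreducible factors such that
`f_i` and `g_i` have the same semigroup and `(f_i, f_j)₀ = (g_i, g_j)₀` for all `i`, `j`. -/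
def Equisingular (f g : PS K) : Prop :=
  ∃ (r : ℕ) (F G : Fin r → PS K),
    (∀ i, IsBranch (F i)) ∧ (∀ i, IsBranch (G i)) ∧
    f = ∏ i, F i ∧ g = ∏ i, G i ∧
    (∀ i, semigroup (F i) = semigroup (G i)) ∧
    ∀ i j, intersectionNumber (F i) (F j) = intersectionNumber (G i) (G j)

/-- The order of contact `d(C,D) = (C,D)₀ / (m(C) m(D))` of two branches. -/
def branchContact (p q : PS K) : ℝ≥0∞ :=
  (intersectionNumber p q : ℝ≥0∞) / ((multiplicity p : ℝ≥0∞) * (multiplicity q : ℝ≥0∞))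

/-- For reduced curves `C`, `D`, `d(C,D)` is the infimum of the `d(C_i,D_j)`, where `C_i`, `D_j` run
over the irreducible components (the irreducible factors of the equations; the choice of a factor
up to a unit does not matter). -/
def contact (f g : PS K) : ℝ≥0∞ :=
  ⨅ (p : PS K) (_ : IsBranch p ∧ p ∣ f) (q : PS K) (_ : IsBranch q ∧ q ∣ g), branchContact p q

/-- The contact exponent `d(C)`: the supremum of `d(C,W)` over all smooth branches `W`. -/
def contactExponent (f : PS K) : ℝ≥0∞ :=
  ⨆ (w : PS K) (_ : IsSmoothBranch w), contact f w

end PlaneCurve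

end

/-! The argument avoids parametrizations, so it works in every characteristic. After a generic
shear, Weierstrass preparation replaces a branch `f` of multiplicity `n` by a monic irreducible `F ∈
K⟦x⟧[y]` of degree `n`, and `K[[x,y]]/(f)` becomes `K⟦x⟧[y]/(F)`. There `(f,g)₀` is the order of the
norm of `g` (Smith normal form). Since `K((x))` is complete, this order is a valuation
(`min_le_normOrder_add`). Since `K` is algebraically closed, two nonzero elements of equal value
agree, up to a constant factor, to higher order (`exists_normOrder_lt_sub`).

For a singular branch, correct a series `φ` term by term so that `ord F(φ)`, the value of `y - φ`,
grows. If this value were always a multiple of `n`, the process would never stop and `F` would have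
a root. So some `b = ord F(φ)` is not divisible by `n` (`exists_not_dvd_order_eval`). Writing `P =
P(φ) + (y - φ)Q` shows that every value below `b` is a multiple of `n`. Hence `b` is the least
element of `Γ` outside `nℕ`, that is `v₁`, while `n = v₀`. No smooth curve meets `f` with number
above `b`, so the contact exponent is `v₁/v₀`; a smooth branch has infinite contact with itself.

For several branches the tool is an ultrametric inequality for contacts of two branches with a
smooth curve `y = φ` (`strong_triangle`). It comes from the Taylor expansion of `G` at `φ`: the
Newton polygon of an irreducible polynomial is one segment, which bounds each term. A smooth curve
of maximal contact with one branch then turns `d(C)` into the minimum of all `d(C_i)` and all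
`d(C_i,C_j)` (`contactExponent_prod`). These depend only on semigroups and mutual intersection
numbers, hence the invariance. -/

open Polynomial

namespace PlaneCurve

/-! ### Newton polygons over complete valued fields. -/

section NewtonPolygon

open scoped Valued

/-- The Newton polygon of an irreducible monic polynomial over a complete field with a rank one
valuation is a single segment. -/
theorem valuation_coeff_pow_le_of_irreducible {k Γ₀ : Type*} [Field k]
    [LinearOrderedCommGroupWithZero Γ₀] [Valued k Γ₀] [(Valued.v : Valuation k Γ₀).RankOne]
    [CompleteSpace k] {P : k[X]} (hm : P.Monic) (hP : Irreducible P) {j : ℕ}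
    (hj : j ≤ P.natDegree) :
    Valued.v (P.coeff j) ^ P.natDegree ≤ Valued.v (P.coeff 0) ^ (P.natDegree - j) := by
  rcases hj.eq_or_lt with rfl | hj
  · simp [hm.coeff_natDegree]
  rw [← map_pow, ← map_pow, ← Valued.toNormedField.norm_le_iff, norm_pow, norm_pow]
  have : Fact (Irreducible P) := ⟨hP⟩
  have hmin : minpoly k (AdjoinRoot.root P) = P := by
    rw [AdjoinRoot.minpoly_root hP.ne_zero, hm.leadingCoeff, inv_one, C_1, mul_one]
  have : FiniteDimensional k (AdjoinRoot P) := (AdjoinRoot.powerBasis hP.ne_zero).finite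
  -- The spectral norm of the root is by definition the supremum of `‖a_j‖ ^ (1/(d-j))`. By
  -- uniqueness of the extended norm it equals the term `j = 0`, so that term dominates all others.
  have h0 := spectralNorm.spectralNorm_eq_norm_coeff_zero_rpow k (AdjoinRoot P)
    (AdjoinRoot.root P)
  rw [spectralNorm, hmin] at h0
  have h1 : ‖P.coeff j‖ ^ (1 / (P.natDegree - j : ℝ)) ≤
      ‖P.coeff 0‖ ^ (1 / P.natDegree : ℝ) := by
    rw [← h0, ← spectralValueTerms_of_lt_natDegree P hj]
    exact le_ciSup (spectralValueTerms_bddAbove P) j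
  have hd : (0 : ℝ) < P.natDegree := by exact_mod_cast (Nat.zero_le j).trans_lt hj
  have hdj : (0 : ℝ) < P.natDegree - j := by
    have : (j : ℝ) < P.natDegree := by exact_mod_cast hj
    linarith
  have h2 := Real.rpow_le_rpow (by positivity) h1
    (mul_nonneg hd.le hdj.le)
  rw [← Real.rpow_mul (norm_nonneg _), ← Real.rpow_mul (norm_nonneg _),
    show 1 / (P.natDegree - j : ℝ) * (P.natDegree * (P.natDegree - j)) = (P.natDegree : ℝ) by
      field_simp,
    show 1 / (P.natDegree : ℝ) * (P.natDegree * (P.natDegree - j)) = ((P.natDegree - j : ℕ) : ℝ) by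
      rw [Nat.cast_sub hj.le]; field_simp, Real.rpow_natCast, Real.rpow_natCast] at h2
  exact h2

end NewtonPolygon

/-! ### Newton polygons and integrality over `K⟦X⟧`. -/

section LaurentSeries

open scoped LaurentSeries
open PowerSeries WithZero

variable {K : Type*} [Field K]

/-- The `X`-adic valuation of Laurent series has rank one. -/
theorem nonempty_rankOne_laurentSeries :
    Nonempty (Valued.v : Valuation K⸨X⸩ ℤᵐ⁰).RankOne := by
  have : (Valued.v : Valuation K⸨X⸩ ℤᵐ⁰).IsNontrivial := by
    refine ⟨⟨HahnSeries.single 1 1, ?_, ?_⟩⟩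
    · simp
    · have := LaurentSeries.valuation_single_zpow K 1
      rw [this]
      rw [← WithZero.exp_zero, Ne, WithZero.exp_inj]
      decide
  rw [Valuation.nonempty_rankOne_iff_mulArchimedean]
  exact MulArchimedean.comap (MonoidWithZeroHom.ValueGroup₀.embedding
    (f := MonoidWithZeroHom.ofClass (Valued.v : Valuation K⸨X⸩ ℤᵐ⁰))).toMonoidHom
    MonoidWithZeroHom.ValueGroup₀.embedding_strictMono

theorem laurent_valuation_coeff_pow_le {P : K⸨X⸩[X]} (hm : P.Monic) (hP : Irreducible P) {j : ℕ}
    (hj : j ≤ P.natDegree) :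
    (Valued.v (P.coeff j) : ℤᵐ⁰) ^ P.natDegree ≤ Valued.v (P.coeff 0) ^ (P.natDegree - j) := by
  obtain ⟨h⟩ := nonempty_rankOne_laurentSeries (K := K)
  exact valuation_coeff_pow_le_of_irreducible hm hP hj

/-- The one-segment Newton polygon bounds every coefficient by the constant one, so integrality of
the latter suffices. -/
theorem exists_map_eq_of_valuation_coeff_zero_le {P : K⸨X⸩[X]} (hm : P.Monic) (hP : Irreducible P)
    (h0 : (Valued.v (P.coeff 0) : ℤᵐ⁰) ≤ 1) :
    ∃ Q : K⟦X⟧[X], Q.Monic ∧ Q.natDegree = P.natDegree ∧ Q.map (algebraMap K⟦X⟧ K⸨X⸩) = P := by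
  have hlift : P ∈ lifts (algebraMap K⟦X⟧ K⸨X⸩) := by
    rw [lifts_iff_coeff_lifts]
    intro j
    obtain hj | hj := le_or_gt j P.natDegree
    · have h1 := (laurent_valuation_coeff_pow_le hm hP hj).trans (pow_le_one' h0 _)
      have h2 : (Valued.v (P.coeff j) : ℤᵐ⁰) ≤ 1 :=
        (pow_le_one_iff hP.natDegree_pos.ne').1 h1
      exact (LaurentSeries.val_le_one_iff_eq_coe K _).1 h2
    · rw [coeff_eq_zero_of_natDegree_lt hj]
      exact ⟨0, map_zero _⟩
  obtain ⟨Q, hQ, hd, hQm⟩ := lifts_and_natDegree_eq_and_monic hlift hm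
  exact ⟨Q, hQm, hd, hQ⟩

theorem valuation_algebraMap_le_one (a : K⟦X⟧) :
    (Valued.v (algebraMap K⟦X⟧ K⸨X⸩ a) : ℤᵐ⁰) ≤ 1 :=
  (LaurentSeries.val_le_one_iff_eq_coe K _).2 ⟨a, rfl⟩

/-- On power series, comparison of valuations is divisibility. -/
theorem valuation_algebraMap_le_iff {a b : K⟦X⟧} :
    (Valued.v (algebraMap K⟦X⟧ K⸨X⸩ a) : ℤᵐ⁰) ≤ Valued.v (algebraMap K⟦X⟧ K⸨X⸩ b) ↔ b ∣ a := by
  constructor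
  · intro h
    by_cases hb : b = 0
    · subst hb
      have : algebraMap K⟦X⟧ K⸨X⸩ a = 0 := by simpa using h
      rw [(FaithfulSMul.algebraMap_injective K⟦X⟧ K⸨X⸩) (this.trans (map_zero _).symm)]
    · have hb' : algebraMap K⟦X⟧ K⸨X⸩ b ≠ 0 := fun h ↦
        hb (FaithfulSMul.algebraMap_injective K⟦X⟧ K⸨X⸩ (h.trans (map_zero _).symm))
      have h1 : (Valued.v (algebraMap K⟦X⟧ K⸨X⸩ a / algebraMap K⟦X⟧ K⸨X⸩ b) : ℤᵐ⁰) ≤ 1 := by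
        rw [map_div₀]
        exact div_le_one_of_le₀ h zero_le
      obtain ⟨c, hc⟩ := (LaurentSeries.val_le_one_iff_eq_coe K _).1 h1
      refine ⟨c, FaithfulSMul.algebraMap_injective K⟦X⟧ K⸨X⸩ ?_⟩
      rw [map_mul]
      have : algebraMap K⟦X⟧ K⸨X⸩ c = _ := hc
      rw [this]
      field_simp
  · rintro ⟨c, rfl⟩
    rw [map_mul, map_mul]
    exact mul_le_of_le_one_right' (valuation_algebraMap_le_one c)

theorem order_le_order_iff_dvd {a b : K⟦X⟧} : a.order ≤ b.order ↔ a ∣ b := by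
  constructor
  · intro h
    by_cases ha : a = 0
    · subst ha
      rw [order_zero, top_le_iff, order_eq_top] at h
      rw [h]
    · obtain ⟨b', hb'⟩ := (X_pow_dvd_iff (n := a.order.toNat) (φ := b)).2 fun m hm ↦
        coeff_of_lt_order m (lt_of_lt_of_le (by
          rw [← coe_toNat_order ha]; exact_mod_cast hm) h)
      rw [hb', ← X_pow_order_mul_divXPowOrder (f := a)]
      simp only [X_pow_order_mul_divXPowOrder]
      obtain ⟨u, hu⟩ := isUnit_divided_by_X_pow_order ha
      refine ⟨↑u⁻¹ * b', ?_⟩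
      nth_rewrite 2 [← X_pow_order_mul_divXPowOrder (f := a)]
      rw [← hu, mul_assoc, Units.mul_inv_cancel_left]
  · rintro ⟨c, rfl⟩
    rw [order_mul]
    exact le_self_add

/-- The Newton polygon of an irreducible monic polynomial over `K⟦X⟧` is a single segment. -/
theorem natDegree_mul_order_coeff_ge {F : K⟦X⟧[X]} (hm : F.Monic) (hF : Irreducible F) {j : ℕ}
    (hj : j ≤ F.natDegree) :
    (F.natDegree - j : ℕ) * (F.coeff 0).order ≤ F.natDegree * (F.coeff j).order := by
  have h := laurent_valuation_coeff_pow_le (hm.map (algebraMap K⟦X⟧ K⸨X⸩))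
    (hm.irreducible_iff_irreducible_map_fraction_map.1 hF) (j := j) (by rwa [hm.natDegree_map])
  rw [hm.natDegree_map, Polynomial.coeff_map, Polynomial.coeff_map, ← map_pow, ← map_pow, ← map_pow, ← map_pow,
    valuation_algebraMap_le_iff, ← order_le_order_iff_dvd, PowerSeries.order_pow, PowerSeries.order_pow,
    nsmul_eq_mul, nsmul_eq_mul] at h
  exact h

end LaurentSeries

/-! ### Norms under base change and in terms of minimal polynomials. -/

section NormComparison

/-- Norms are compatible with base change. -/
theorem norm_map_of_basis {ι R S k L : Type*} [Fintype ι] [CommRing R] [CommRing S] [Algebra R S]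
    [CommRing k] [CommRing L] [Algebra k L] (b : Module.Basis ι R S) (b' : Module.Basis ι k L)
    (ψ : R →+* k) (φ : S →+* L) (hφ : ∀ r, φ (algebraMap R S r) = algebraMap k L (ψ r))
    (hb : ∀ i, φ (b i) = b' i) (s : S) :
    Algebra.norm k (φ s) = ψ (Algebra.norm R s) := by
  classical
  have hrepr : ∀ t i, b'.repr (φ t) i = ψ (b.repr t i) := by
    intro t i
    have h1 : φ t = ∑ j, ψ (b.repr t j) • b' j := by
      conv_lhs => rw [← b.sum_repr t]
      rw [map_sum]
      refine Finset.sum_congr rfl fun j _ ↦ ?_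
      rw [Algebra.smul_def, map_mul, hφ, hb, Algebra.smul_def]
    rw [h1, b'.repr_sum_self]
  rw [Algebra.norm_eq_matrix_det b, Algebra.norm_eq_matrix_det b', RingHom.map_det]
  congr 1
  ext i j
  rw [RingHom.mapMatrix_apply, Matrix.map_apply, Algebra.leftMulMatrix_eq_repr_mul,
    Algebra.leftMulMatrix_eq_repr_mul, ← hb, ← map_mul, hrepr]

/-- The norm factors through `k(u)`, and the exponent is `[L : k(u)]`. This lets integrality pass
from the norm to the minimal polynomial. -/
theorem norm_eq_coeff_zero_minpoly_pow {k L : Type*} [Field k] [Field L] [Algebra k L]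
    [FiniteDimensional k L] (u : L) :
    ∃ m ≠ 0, Algebra.norm k u =
      ((-1) ^ (minpoly k u).natDegree * (minpoly k u).coeff 0) ^ m := by
  refine ⟨Module.finrank (IntermediateField.adjoin k {u}) L, Module.finrank_pos.ne', ?_⟩
  have hu : IsIntegral k u := Algebra.IsIntegral.isIntegral u
  rw [Algebra.norm_eq_norm_adjoin]
  have := Algebra.PowerBasis.norm_gen_eq_coeff_zero_minpoly
    (IntermediateField.adjoin.powerBasis hu)
  rw [IntermediateField.adjoin.powerBasis_gen, IntermediateField.adjoin.powerBasis_dim,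
    IntermediateField.minpoly_gen] at this
  rw [this]

end NormComparison

/-! ### The order of the norm as a valuation on `K⟦X⟧[Y]/(F)`. -/

section

open scoped LaurentSeries
open PowerSeries WithZero

variable {K : Type*} [Field K]

/-- If the norm of `u` is integral then so is `u`, and the norms of the translates of `u` are given
by a monic polynomial. -/
theorem exists_monic_norm_sub {L : Type*} [Field L] [Algebra K⸨X⸩ L] [FiniteDimensional K⸨X⸩ L]
    {u : L} (hu : (Valued.v (Algebra.norm K⸨X⸩ u) : ℤᵐ⁰) ≤ 1) :
    ∃ Q : K⟦X⟧[X], Q.Monic ∧ 0 < Q.natDegree ∧ ∀ c : K⟦X⟧, ∃ (ε : K⟦X⟧) (m : ℕ),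
      IsUnit ε ∧ m ≠ 0 ∧
      Algebra.norm K⸨X⸩ (u - algebraMap K⸨X⸩ L (algebraMap K⟦X⟧ K⸨X⸩ c)) =
        algebraMap K⟦X⟧ K⸨X⸩ (ε * Q.eval c ^ m) := by
  have hui : IsIntegral K⸨X⸩ u := Algebra.IsIntegral.isIntegral u
  obtain ⟨m, hm, h⟩ := norm_eq_coeff_zero_minpoly_pow (k := K⸨X⸩) u
  have h0 : (Valued.v ((minpoly K⸨X⸩ u).coeff 0) : ℤᵐ⁰) ≤ 1 := by
    rw [h, map_pow, map_mul, map_pow, Valuation.map_neg, map_one, one_pow, one_mul] at hu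
    exact (pow_le_one_iff hm).1 hu
  obtain ⟨Q, hQ, hd, hmap⟩ := exists_map_eq_of_valuation_coeff_zero_le (minpoly.monic hui)
    (minpoly.irreducible hui) h0
  refine ⟨Q, hQ, hd ▸ minpoly.natDegree_pos hui, fun c ↦ ?_⟩
  obtain ⟨m, hm, h⟩ := norm_eq_coeff_zero_minpoly_pow (k := K⸨X⸩)
    (u - algebraMap K⸨X⸩ L (algebraMap K⟦X⟧ K⸨X⸩ c))
  refine ⟨((-1) ^ (minpoly K⸨X⸩
    (u - algebraMap K⸨X⸩ L (algebraMap K⟦X⟧ K⸨X⸩ c))).natDegree) ^ m, m,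
    (isUnit_one.neg.pow _).pow _, hm, ?_⟩
  -- The minimal polynomial of `u - c` is `Q(T + c)`, with constant coefficient `Q(c)`.
  rw [h, minpoly.sub_algebraMap, ← hmap, coeff_zero_eq_eval_zero, eval_comp, eval_add, eval_X,
    eval_C, zero_add, eval_map_algebraMap, aeval_algebraMap_apply, coe_aeval_eq_eval, mul_pow]
  simp only [map_mul, map_pow, map_neg, map_one]

variable {F : K⟦X⟧[X]}

theorem isDomain_adjoinRoot (hF : Irreducible F) : IsDomain (AdjoinRoot F) :=
  AdjoinRoot.isDomain_of_prime hF.prime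

/-- Apply `exists_monic_norm_sub` to `u = h/g` over `K((X))`. Taking `c = -1` will give the
ultrametric inequality; a root `c` of `Q` modulo `X` will give an approximation of `h` by `c g`. -/
theorem exists_norm_sub_algebraMap_mul (hm : F.Monic) (hF : Irreducible F) {g h : AdjoinRoot F}
    (hg : g ≠ 0) (hgh : Algebra.norm K⟦X⟧ g ∣ Algebra.norm K⟦X⟧ h) :
    ∃ Q : K⟦X⟧[X], Q.Monic ∧ 0 < Q.natDegree ∧ ∀ c : K⟦X⟧, ∃ (ε : K⟦X⟧) (m : ℕ),
      IsUnit ε ∧ m ≠ 0 ∧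
      Algebra.norm K⟦X⟧ (h - algebraMap K⟦X⟧ (AdjoinRoot F) c * g) =
        Algebra.norm K⟦X⟧ g * (ε * Q.eval c ^ m) := by
  have hinj := FaithfulSMul.algebraMap_injective K⟦X⟧ K⸨X⸩
  have hm' := hm.map (algebraMap K⟦X⟧ K⸨X⸩)
  have : Fact (Irreducible (F.map (algebraMap K⟦X⟧ K⸨X⸩))) :=
    ⟨hm.irreducible_iff_irreducible_map_fraction_map.1 hF⟩
  have : FiniteDimensional K⸨X⸩ (AdjoinRoot (F.map (algebraMap K⟦X⟧ K⸨X⸩))) :=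
    (AdjoinRoot.powerBasis' hm').finite
  have := isDomain_adjoinRoot hF
  have := (AdjoinRoot.powerBasis' hm).finite
  have := Module.Free.of_basis (AdjoinRoot.powerBasis' hm).basis
  let φ := AdjoinRoot.map (algebraMap K⟦X⟧ K⸨X⸩) F (F.map (algebraMap K⟦X⟧ K⸨X⸩)) dvd_rfl
  have hφ : ∀ r, φ (algebraMap _ _ r) = algebraMap K⸨X⸩ _ (algebraMap K⟦X⟧ K⸨X⸩ r) := by
    intro r
    simp [φ, AdjoinRoot.algebraMap_eq]
  have hN : ∀ s, Algebra.norm K⸨X⸩ (φ s) = algebraMap K⟦X⟧ K⸨X⸩ (Algebra.norm K⟦X⟧ s) := by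
    have hdim : (AdjoinRoot.powerBasis' hm').dim = (AdjoinRoot.powerBasis' hm).dim := by
      simp [hm.natDegree_map]
    refine norm_map_of_basis (AdjoinRoot.powerBasis' hm).basis
      ((AdjoinRoot.powerBasis' hm').basis.reindex (finCongr hdim)) _ φ hφ fun i ↦ ?_
    simp [φ, PowerBasis.coe_basis]
  have hNg : Algebra.norm K⟦X⟧ g ≠ 0 := by rwa [Ne, Algebra.norm_eq_zero_iff]
  have hφg : φ g ≠ 0 := by
    intro h0
    have := hN g
    rw [h0, Algebra.norm_zero, eq_comm] at this
    exact hNg (hinj (this.trans (map_zero _).symm))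
  have hNg' : algebraMap K⟦X⟧ K⸨X⸩ (Algebra.norm K⟦X⟧ g) ≠ 0 :=
    fun h0 ↦ hNg (hinj (h0.trans (map_zero _).symm))
  obtain ⟨Q, hQ, hd, H⟩ := exists_monic_norm_sub (K := K) (u := φ h / φ g) (by
    have h1 : Algebra.norm K⸨X⸩ (φ h / φ g) = algebraMap K⟦X⟧ K⸨X⸩ (Algebra.norm K⟦X⟧ h) /
        algebraMap K⟦X⟧ K⸨X⸩ (Algebra.norm K⟦X⟧ g) := by
      rw [eq_div_iff hNg', ← hN, ← map_mul, div_mul_cancel₀ _ hφg, hN]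
    rw [h1, map_div₀]
    exact div_le_one_of_le₀ (valuation_algebraMap_le_iff.2 hgh) zero_le)
  refine ⟨Q, hQ, hd, fun c ↦ ?_⟩
  obtain ⟨ε, m, hε, hm0, h1⟩ := H c
  refine ⟨ε, m, hε, hm0, hinj ?_⟩
  rw [map_mul, ← h1, ← hN, ← hN, ← map_mul, map_sub, map_mul, hφ, mul_sub,
    mul_div_cancel₀ _ hφg, mul_comm (φ g)]

/-- The order of the norm of an element of `K⟦X⟧[Y]/(F)`. -/
noncomputable def normOrder (s : AdjoinRoot F) : ℕ∞ := (Algebra.norm K⟦X⟧ s).order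

theorem normOrder_mul (g h : AdjoinRoot F) : normOrder (g * h) = normOrder g + normOrder h := by
  rw [normOrder, map_mul, PowerSeries.order_mul, normOrder, normOrder]

theorem normOrder_eq_top_iff (hm : F.Monic) (hF : Irreducible F) {g : AdjoinRoot F} :
    normOrder g = ⊤ ↔ g = 0 := by
  have := isDomain_adjoinRoot hF
  have := (AdjoinRoot.powerBasis' hm).finite
  have := Module.Free.of_basis (AdjoinRoot.powerBasis' hm).basis
  rw [normOrder, PowerSeries.order_eq_top, Algebra.norm_eq_zero_iff]

theorem normOrder_algebraMap (hm : F.Monic) (a : K⟦X⟧) :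
    normOrder (algebraMap K⟦X⟧ (AdjoinRoot F) a) = F.natDegree * a.order := by
  rw [normOrder, Algebra.norm_algebraMap_of_basis (AdjoinRoot.powerBasis' hm).basis,
    PowerSeries.order_pow, nsmul_eq_mul, Fintype.card_fin, AdjoinRoot.powerBasis'_dim]

theorem normOrder_neg (g : AdjoinRoot F) : normOrder (-g) = normOrder g := by
  have h := normOrder_mul (-g) (-g)
  have h' := normOrder_mul g g
  rw [neg_mul_neg, h'] at h
  generalize normOrder g = a at *
  generalize normOrder (-g) = b at *
  cases a <;> cases b
  · rfl
  · simp at h; exact absurd h (by exact_mod_cast ENat.top_ne_natCast _)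
  · simp at h
  · norm_cast at h ⊢; omega

/-- `F` is the characteristic polynomial of multiplication by the root, so the norm of `a - y` is
`F(a)`. -/
theorem normOrder_root_sub (hm : F.Monic) (a : K⟦X⟧) :
    normOrder (AdjoinRoot.mk F (Polynomial.X - Polynomial.C a)) = (F.eval a).order := by
  set pb := AdjoinRoot.powerBasis' hm
  set M := Algebra.leftMulMatrix pb.basis (AdjoinRoot.root F)
  have hM : M.charpoly = F := by
    refine eq_of_monic_of_dvd_of_natDegree_le hm M.charpoly_monic ?_ ?_
    · rw [← AdjoinRoot.mk_eq_zero, ← AdjoinRoot.aeval_eq]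
      refine Algebra.leftMulMatrix_injective pb.basis ?_
      rw [← Polynomial.aeval_algHom_apply, Matrix.aeval_self_charpoly, map_zero]
    · rw [Matrix.charpoly_natDegree_eq_dim, Fintype.card_fin, AdjoinRoot.powerBasis'_dim]
  have h1 : Algebra.norm K⟦X⟧ (-AdjoinRoot.mk F (Polynomial.X - Polynomial.C a)) = F.eval a := by
    conv_rhs => rw [← hM]
    rw [Matrix.eval_charpoly, Algebra.norm_eq_matrix_det pb.basis]
    congr 1
    rw [map_sub, AdjoinRoot.mk_X, AdjoinRoot.mk_C, ← AdjoinRoot.algebraMap_eq, neg_sub, map_sub,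
      AlgHom.commutes]
    rfl
  rw [← normOrder_neg, normOrder, h1]

/-- The order of the norm satisfies the ultrametric inequality. -/
theorem min_le_normOrder_add (hm : F.Monic) (hF : Irreducible F) (g h : AdjoinRoot F) :
    min (normOrder g) (normOrder h) ≤ normOrder (g + h) := by
  wlog hgh : normOrder g ≤ normOrder h generalizing g h
  · rw [min_comm, add_comm]
    exact this _ _ (le_of_not_ge hgh)
  rw [min_eq_left hgh]
  by_cases hg : g = 0
  · rw [(normOrder_eq_top_iff hm hF).2 hg, top_le_iff, normOrder_eq_top_iff hm hF] at hgh
    rw [hgh, add_zero]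
  obtain ⟨Q, hQ, hd, H⟩ := exists_norm_sub_algebraMap_mul hm hF hg
    (order_le_order_iff_dvd.1 hgh)
  obtain ⟨ε, m, -, -, h1⟩ := H (-1)
  rw [map_neg, map_one, neg_one_mul, sub_neg_eq_add] at h1
  rw [normOrder, normOrder, order_le_order_iff_dvd, add_comm g h, h1]
  exact dvd_mul_right _ _

/-- Elements of the same value agree to first order up to a constant. -/
theorem exists_normOrder_lt_sub [IsAlgClosed K] (hm : F.Monic) (hF : Irreducible F)
    {g h : AdjoinRoot F} (hgh : normOrder g = normOrder h) (hg : g ≠ 0) :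
    ∃ c : K, c ≠ 0 ∧ normOrder g <
      normOrder (h - algebraMap K⟦X⟧ (AdjoinRoot F) (PowerSeries.C c) * g) := by
  have hgt : normOrder g ≠ ⊤ := by rwa [Ne, normOrder_eq_top_iff hm hF]
  obtain ⟨Q, hQ, hd, H⟩ := exists_norm_sub_algebraMap_mul hm hF hg
    (order_le_order_iff_dvd.1 hgh.le)
  have horder : ∀ c : K⟦X⟧, ∃ m : ℕ, m ≠ 0 ∧ normOrder (h - algebraMap K⟦X⟧ (AdjoinRoot F) c * g) =
      normOrder g + m * (Q.eval c).order := by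
    intro c
    obtain ⟨ε, m, hε, hm0, h1⟩ := H c
    refine ⟨m, hm0, ?_⟩
    rw [normOrder, h1, PowerSeries.order_mul, PowerSeries.order_mul, order_zero_of_unit hε,
      zero_add, PowerSeries.order_pow, nsmul_eq_mul, normOrder]
  have hev : ∀ c : K, PowerSeries.constantCoeff (Q.eval (PowerSeries.C c)) =
      (Q.map PowerSeries.constantCoeff).eval c := by
    intro c
    rw [eval_map, ← eval₂_at_apply]
    simp
  obtain ⟨c, hc⟩ := IsAlgClosed.exists_root (Q.map (PowerSeries.constantCoeff (R := K)))
    (by rw [hQ.degree_map]; exact (natDegree_pos_iff_degree_pos.1 hd).ne')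
  -- `c` is a root of `Q` modulo `X`, so `Q(c)` has positive order. For `c = 0` this would make the
  -- value of `h` exceed that of `g`.
  refine ⟨c, ?_, ?_⟩
  · rintro rfl
    obtain ⟨m, hm0, h1⟩ := horder (PowerSeries.C 0)
    rw [map_zero, map_zero, zero_mul, sub_zero, ← hgh] at h1
    have h2 : (m : ℕ∞) * (Q.eval 0).order = 0 := by
      refine ENat.add_right_injective_of_ne_top hgt ?_
      simpa using h1.symm
    rw [mul_eq_zero, Nat.cast_eq_zero, or_iff_right hm0] at h2
    refine order_ne_zero_iff_constCoeff_eq_zero.2 ?_ h2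
    have := hev 0
    rw [map_zero] at this
    rwa [this]
  · obtain ⟨m, hm0, h1⟩ := horder (PowerSeries.C c)
    rw [h1]
    rw [add_comm]
    refine ENat.lt_add_left hgt (pos_iff_ne_zero.2 (mul_ne_zero (by exact_mod_cast hm0) ?_))
    rw [order_ne_zero_iff_constCoeff_eq_zero, hev]
    exact hc

end

/-! ### Intersection numbers as orders of norms. -/

section Dimension

open PowerSeries

variable {K : Type*} [Field K]

/-- The quotient of `K⟦X⟧` by a nonzero power series has dimension its order. -/
theorem finite_and_finrank_quotient_span {a : K⟦X⟧} (ha : a ≠ 0) :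
    Module.Finite K (K⟦X⟧ ⧸ Ideal.span {a}) ∧
      (Module.finrank K (K⟦X⟧ ⧸ Ideal.span {a}) : ℕ∞) = a.order := by
  set m := a.order.toNat with hm
  have hm' : (m : ℕ∞) = a.order := coe_toNat_order ha
  let T : K⟦X⟧ →ₗ[K] (Fin m → K) := LinearMap.pi fun i ↦ PowerSeries.coeff (i : ℕ)
  have hT : Function.Surjective T := by
    intro v
    refine ⟨PowerSeries.mk fun i ↦ if h : i < m then v ⟨i, h⟩ else 0, ?_⟩
    ext i
    simp [T, coeff_mk]
  have hker : LinearMap.ker T = (Ideal.span {a}).restrictScalars K := by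
    ext b
    rw [LinearMap.mem_ker, Submodule.restrictScalars_mem, Ideal.mem_span_singleton,
      ← order_le_order_iff_dvd, ← hm']
    constructor
    · intro h
      refine nat_le_order _ _ fun i hi ↦ ?_
      exact congrFun h ⟨i, hi⟩
    · intro h
      ext i
      exact coeff_of_lt_order _ (lt_of_lt_of_le (by exact_mod_cast i.2) h)
  let e : (K⟦X⟧ ⧸ Ideal.span {a}) ≃ₗ[K] (Fin m → K) :=
    (Submodule.Quotient.restrictScalarsEquiv K (Ideal.span {a})).symm.trans
      ((Submodule.quotEquivOfEq _ _ hker.symm).trans (T.quotKerEquivOfSurjective hT))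
  refine ⟨Module.Finite.equiv e.symm, ?_⟩
  rw [LinearEquiv.finrank_eq e, Module.finrank_fin_fun, hm']

theorem order_prod_eq {ι : Type*} (s : Finset ι) (a : ι → K⟦X⟧) :
    (∏ i ∈ s, a i).order = ∑ i ∈ s, (a i).order := by
  classical
  induction s using Finset.induction_on with
  | empty => simp
  | insert i s hi ih => rw [Finset.prod_insert hi, Finset.sum_insert hi, order_mul, ih]

/-- For `s ≠ 0`, Smith normal form over `K⟦X⟧` splits the quotient into pieces `K⟦X⟧/(c_i)`, and the
norm of `s` is associated to `∏ c_i`. For `s = 0` both sides are infinite. -/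
theorem toENat_rank_quotient_span_eq_normOrder {F : K⟦X⟧[X]} (hm : F.Monic) (hF : Irreducible F)
    (s : AdjoinRoot F) :
    Cardinal.toENat (Module.rank K (AdjoinRoot F ⧸ Ideal.span {s})) = normOrder s := by
  have := isDomain_adjoinRoot hF
  set b := (AdjoinRoot.powerBasis' hm).basis
  have := Module.Free.of_basis b
  by_cases hs : s = 0
  · rw [(normOrder_eq_top_iff hm hF).2 hs, Cardinal.toENat_eq_top, ← not_lt, hs]
    intro h
    have h1 : Module.Finite K (AdjoinRoot F ⧸ Ideal.span {(0 : AdjoinRoot F)}) :=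
      Module.rank_lt_aleph0_iff.1 h
    have hinj : Function.Injective ((Ideal.Quotient.mkₐ K (Ideal.span {(0 : AdjoinRoot F)})).comp
        (IsScalarTower.toAlgHom K K⟦X⟧ (AdjoinRoot F))) := by
      rw [injective_iff_map_eq_zero]
      intro a ha
      simp only [AlgHom.comp_apply, Ideal.Quotient.mkₐ_eq_mk, Ideal.Quotient.eq_zero_iff_mem,
        Ideal.mem_span_singleton, zero_dvd_iff] at ha
      exact FaithfulSMul.algebraMap_injective K⟦X⟧ (AdjoinRoot F) (by simpa using ha)
    have h2 : Module.Finite K K⟦X⟧ :=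
      Module.Finite.of_injective ((Ideal.Quotient.mkₐ K (Ideal.span {(0 : AdjoinRoot F)})).comp
        (IsScalarTower.toAlgHom K K⟦X⟧ (AdjoinRoot F))).toLinearMap hinj
    set N := Module.finrank K K⟦X⟧
    have h3 := (finite_and_finrank_quotient_span (pow_ne_zero (N + 1) (PowerSeries.X_ne_zero (R := K)))).2
    rw [order_X_pow, Nat.cast_inj] at h3
    have h4 : Module.finrank K (K⟦X⟧ ⧸ Ideal.span {(PowerSeries.X : K⟦X⟧) ^ (N + 1)}) ≤ N :=
      LinearMap.finrank_le_finrank_of_surjective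
        (f := (Ideal.Quotient.mkₐ K (Ideal.span {(PowerSeries.X : K⟦X⟧) ^ (N + 1)})).toLinearMap)
        (Ideal.Quotient.mkₐ_surjective K _)
    omega
  · have hI : Ideal.span {s} ≠ ⊥ := by rwa [Ne, Ideal.span_singleton_eq_bot]
    have hc := Ideal.smithCoeffs_ne_zero b (Ideal.span {s}) hI
    have hfin := fun i ↦ (finite_and_finrank_quotient_span (hc i)).1
    have h1 := Ideal.finrank_quotient_eq_sum K hI b
    have h2 : Module.Finite K (AdjoinRoot F ⧸ Ideal.span {s}) :=
      Module.Finite.equiv (Ideal.quotientEquivDirectSum K b hI).symm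
    rw [← Module.finrank_eq_rank, map_natCast, h1, normOrder]
    have h3 := associated_norm_prod_smith b hs
    rw [le_antisymm (order_le_order_iff_dvd.2 h3.dvd) (order_le_order_iff_dvd.2 h3.symm.dvd),
      order_prod_eq, Nat.cast_sum]
    exact Finset.sum_congr rfl fun i _ ↦ (finite_and_finrank_quotient_span (hc i)).2

theorem intersectionNumber_eq_of_surjective {F : K⟦X⟧[X]} (hm : F.Monic) (hF : Irreducible F)
    {f : PS K} (θ : PS K →ₐ[K] AdjoinRoot F) (hθ : Function.Surjective θ)
    (hker : ∀ g, θ g = 0 ↔ f ∣ g) (g : PS K) : intersectionNumber f g = normOrder (θ g) := by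
  rw [← toENat_rank_quotient_span_eq_normOrder hm hF]
  let ψ : PS K →ₐ[K] (AdjoinRoot F ⧸ Ideal.span {θ g}) :=
    (Ideal.Quotient.mkₐ K (Ideal.span {θ g})).comp θ
  have hψ : Function.Surjective ψ := (Ideal.Quotient.mkₐ_surjective K _).comp hθ
  have hk : RingHom.ker ψ = Ideal.span {f, g} := by
    ext p
    rw [RingHom.mem_ker, AlgHom.comp_apply, Ideal.Quotient.mkₐ_eq_mk, Ideal.Quotient.eq_zero_iff_mem,
      Ideal.mem_span_singleton, Ideal.mem_span_pair]
    constructor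
    · rintro ⟨c, hc⟩
      obtain ⟨c, rfl⟩ := hθ c
      obtain ⟨a, ha⟩ := (hker (p - g * c)).1 (by rw [map_sub, map_mul, hc, sub_self])
      exact ⟨a, c, by linear_combination -ha⟩
    · rintro ⟨a, c, rfl⟩
      rw [map_add, map_mul, (hker f).2 dvd_rfl, mul_zero, zero_add, map_mul]
      exact dvd_mul_left _ _
  rw [intersectionNumber, ← ((Ideal.quotientEquivAlgOfEq K hk).symm.trans
    (Ideal.quotientKerAlgEquivOfSurjective hψ)).toLinearEquiv.rank_eq]

end Dimension

/-! ### Weierstrass preparation; variable `0` plays the role of `y`, variable `1` that of `x`. -/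

section Coordinates

variable {K : Type*} [Field K]

/-- The identification of `K[[y, x]]` with `K[[x]][[y]]`. -/
noncomputable def iterEquiv (K : Type*) [Field K] : PS K ≃ₐ[K] PowerSeries (PowerSeries K) :=
  (MvPowerSeries.renameEquiv K ((finSuccEquiv 1).trans
    (Equiv.optionCongr (Equiv.ofUnique (Fin 1) Unit)))).trans (MvPowerSeries.optionEquivLeft Unit K)

theorem coeff_coeff_iterEquiv (p : PS K) (i j : ℕ) :
    PowerSeries.coeff j (PowerSeries.coeff i (iterEquiv K p)) =
      MvPowerSeries.coeff (Finsupp.single 0 i + Finsupp.single 1 j) p := by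
  rw [PowerSeries.coeff_def (s := Finsupp.single () j) (by simp), iterEquiv, AlgEquiv.trans_apply,
    MvPowerSeries.coeff_coeff_optionEquivLeft]
  set e := (finSuccEquiv 1).trans (Equiv.optionCongr (Equiv.ofUnique (Fin 1) Unit))
  have h : Finsupp.optionElim i (Finsupp.single () j) =
      Finsupp.embDomain e.toEmbedding (Finsupp.single 0 i + Finsupp.single 1 j) := by
    ext a
    obtain ⟨a, rfl⟩ := e.surjective a
    have h1 : e a = e.toEmbedding a := rfl
    conv_rhs => rw [h1, Finsupp.embDomain_apply_self]
    fin_cases a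
    · have : e 0 = none := rfl
      simp [this]
    · have : e 1 = some () := rfl
      simp [this]
  rw [h]
  exact MvPowerSeries.coeff_embDomain_rename e.toEmbedding p _

instance : IsAdicComplete (IsLocalRing.maximalIdeal (PowerSeries K)) (PowerSeries K) := by
  rw [PowerSeries.maximalIdeal_eq_span_X]
  infer_instance

theorem mem_maximalIdeal_iff {a : PowerSeries K} :
    a ∈ IsLocalRing.maximalIdeal (PowerSeries K) ↔ PowerSeries.constantCoeff a = 0 := by
  rw [PowerSeries.maximalIdeal_eq_span_X, Ideal.mem_span_singleton, PowerSeries.X_dvd_iff]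

/-- The curve `f = 0` is transverse to the line `x = 0`. -/
def IsTransverse (f : PS K) : Prop :=
  ∃ n : ℕ, f.order = n ∧ MvPowerSeries.coeff (Finsupp.single 0 n) f ≠ 0

/-- The polynomial `F` as an element of `K[[y, x]]`. -/
noncomputable def ofPoly (F : (PowerSeries K)[X]) : PS K :=
  (iterEquiv K).symm (F : PowerSeries (PowerSeries K))

theorem ofPoly_mul (F G : (PowerSeries K)[X]) : ofPoly (F * G) = ofPoly F * ofPoly G := by
  simp [ofPoly]

theorem coeff_ofPoly (F : (PowerSeries K)[X]) (i j : ℕ) :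
    MvPowerSeries.coeff (Finsupp.single 0 i + Finsupp.single 1 j) (ofPoly F) =
      PowerSeries.coeff j (F.coeff i) := by
  rw [← coeff_coeff_iterEquiv, ofPoly, AlgEquiv.apply_symm_apply, Polynomial.coeff_coe]

theorem finsupp_fin_two_eq (d : Fin 2 →₀ ℕ) :
    d = Finsupp.single 0 (d 0) + Finsupp.single 1 (d 1) := by
  ext i
  fin_cases i <;> simp

/-- Weierstrass preparation for transverse curves. -/
theorem IsTransverse.exists_weierstrass {f : PS K} {n : ℕ} (hf : IsTransverse f)
    (hn : f.order = n) : ∃ (F : (PowerSeries K)[X]) (u : PS K), IsUnit u ∧ f = ofPoly F * u ∧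
      F.IsDistinguishedAt (IsLocalRing.maximalIdeal (PowerSeries K)) ∧ F.natDegree = n ∧
      ∀ i, (n : ℕ∞) ≤ i + (F.coeff i).order := by
  obtain ⟨n', hn', hc⟩ := hf
  obtain rfl : n' = n := by rw [hn] at hn'; exact_mod_cast hn'.symm
  have hres : ∀ i, PowerSeries.coeff i ((iterEquiv K f).map
      (IsLocalRing.residue (PowerSeries K))) = 0 ↔
      MvPowerSeries.coeff (Finsupp.single 0 i) f = 0 := by
    intro i
    rw [PowerSeries.coeff_map, IsLocalRing.residue_eq_zero_iff, mem_maximalIdeal_iff,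
      ← PowerSeries.coeff_zero_eq_constantCoeff_apply, coeff_coeff_iterEquiv, Finsupp.single_zero,
      add_zero]
  have hord : ((iterEquiv K f).map (IsLocalRing.residue (PowerSeries K))).order = n' := by
    rw [PowerSeries.order_eq_nat]
    refine ⟨fun h ↦ hc ((hres _).1 h), fun i hi ↦ (hres i).2 ?_⟩
    refine MvPowerSeries.coeff_of_lt_order ?_
    rw [hn, Finsupp.degree_single]
    exact_mod_cast hi
  have hne : (iterEquiv K f).map (IsLocalRing.residue (PowerSeries K)) ≠ 0 := by
    intro h
    rw [h, PowerSeries.order_zero] at hord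
    exact ENat.top_ne_natCast _ hord
  obtain ⟨F, h, H⟩ := PowerSeries.exists_isWeierstrassFactorization hne
  have hu : IsUnit ((iterEquiv K).symm h) := H.isUnit.map _
  have hf : f = ofPoly F * (iterEquiv K).symm h := by
    rw [ofPoly, ← map_mul, ← H.eq_mul, AlgEquiv.symm_apply_apply]
  refine ⟨F, _, hu, hf, H.isDistinguishedAt, ?_, fun i ↦ ?_⟩
  · rw [H.natDegree_eq_toNat_order_map, hord, ENat.toNat_natCast]
  · obtain ⟨v, hv⟩ := hu
    -- Dividing by the unit preserves total order at least `n`, which bounds each coefficient of `F`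
    -- from below.
    have h1 : (n' : ℕ∞) ≤ (ofPoly F).order := by
      have : ofPoly F = f * ↑v⁻¹ := by rw [hf, ← hv, Units.mul_inv_cancel_right]
      rw [this, ← hn]
      exact le_self_add.trans MvPowerSeries.le_order_mul
    by_cases hi : F.coeff i = 0
    · simp [hi]
    · have h2 := PowerSeries.coeff_order hi
      rw [← coeff_ofPoly] at h2
      have h3 := h1.trans (MvPowerSeries.order_le h2)
      rw [map_add, Finsupp.degree_single, Finsupp.degree_single, Nat.cast_add,
        PowerSeries.coe_toNat_order hi] at h3
      exact h3

theorem algebraMap_eq_ofPoly (c : K) :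
    algebraMap K (PS K) c = ofPoly (C (PowerSeries.C c)) := by
  apply (iterEquiv K).injective
  rw [ofPoly, AlgEquiv.apply_symm_apply, AlgEquiv.commutes, Polynomial.coe_C,
    PowerSeries.algebraMap_apply]
  rfl

/-- The reduction of power series in two variables modulo a distinguished polynomial. -/
theorem exists_algHom_adjoinRoot {F : (PowerSeries K)[X]}
    (hF : F.IsDistinguishedAt (IsLocalRing.maximalIdeal (PowerSeries K))) :
    ∃ θ : PS K →ₐ[K] AdjoinRoot F, Function.Surjective θ ∧ (∀ g, θ g = 0 ↔ ofPoly F ∣ g) ∧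
      ∀ G, θ (ofPoly G) = AdjoinRoot.mk F G := by
  -- Weierstrass division: modulo `F`, every series in `y` is a polynomial.
  let e : AdjoinRoot F ≃+* (PowerSeries (PowerSeries K)) ⧸ Ideal.span {(F : PowerSeries (PowerSeries K))} :=
    @AlgEquiv.toRingEquiv _ _ _ _ _ _ _ (_) hF.algEquivQuotient
  have he : ∀ G : (PowerSeries K)[X], e (AdjoinRoot.mk F G) =
      Ideal.Quotient.mk _ (G : PowerSeries (PowerSeries K)) := fun G ↦ rfl
  let θ₀ : PS K →+* AdjoinRoot F := (e.symm : _ →+* AdjoinRoot F).comp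
    ((Ideal.Quotient.mk (Ideal.span {(F : PowerSeries (PowerSeries K))})).comp
      (iterEquiv K : PS K →+* PowerSeries (PowerSeries K)))
  have hθ : ∀ g, θ₀ g = e.symm (Ideal.Quotient.mk _ (iterEquiv K g)) := fun _ ↦ rfl
  have hpoly : ∀ G, θ₀ (ofPoly G) = AdjoinRoot.mk F G := by
    intro G
    rw [hθ, RingEquiv.symm_apply_eq, he, ofPoly, AlgEquiv.apply_symm_apply]
  refine ⟨⟨θ₀, ?_⟩, ?_, ?_, hpoly⟩
  · intro c
    change θ₀ (algebraMap K (PS K) c) = _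
    rw [algebraMap_eq_ofPoly, hpoly, AdjoinRoot.mk_C, ← AdjoinRoot.algebraMap_eq,
      IsScalarTower.algebraMap_apply K (PowerSeries K) (AdjoinRoot F)]
    rfl
  · exact (e.symm.surjective.comp Ideal.Quotient.mk_surjective).comp (iterEquiv K).surjective
  · intro g
    change θ₀ g = 0 ↔ _
    rw [hθ, map_eq_zero_iff _ e.symm.injective, Ideal.Quotient.eq_zero_iff_mem,
      Ideal.mem_span_singleton, ← map_dvd_iff (iterEquiv K), ofPoly, AlgEquiv.apply_symm_apply]

/-- Modulo `x`, `F` is a power of `y`, hence so is each monic factor. A factor that is a unit as a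
power series has nonzero constant term there, so it reduces to `y⁰` and has degree zero. -/
theorem irreducible_of_irreducible_ofPoly {F : (PowerSeries K)[X]}
    (hF : F.IsDistinguishedAt (IsLocalRing.maximalIdeal (PowerSeries K)))
    (h : Irreducible (ofPoly F)) : Irreducible F := by
  have hm := hF.monic
  have hmap : F.map (PowerSeries.constantCoeff (R := K)) = X ^ F.natDegree := by
    ext i
    rw [coeff_map, coeff_X_pow]
    split_ifs with hi
    · rw [hi, hm.coeff_natDegree, map_one]
    · rcases lt_or_gt_of_ne hi with hi | hi
      · exact mem_maximalIdeal_iff.1 (hF.mem hi)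
      · rw [coeff_eq_zero_of_natDegree_lt hi, map_zero]
  have key : ∀ G H : (PowerSeries K)[X], G.Monic → G * H = F → IsUnit (ofPoly G) →
      G.natDegree = 0 := by
    intro G H hG hGH hu
    have h0 : PowerSeries.constantCoeff (G.coeff 0) ≠ 0 := by
      rw [ofPoly, isUnit_map_iff, PowerSeries.isUnit_iff_constantCoeff,
        PowerSeries.isUnit_iff_constantCoeff, isUnit_iff_ne_zero,
        ← PowerSeries.coeff_zero_eq_constantCoeff_apply (R := PowerSeries K),
        Polynomial.coeff_coe] at hu
      exact hu
    have h1 : G.map (PowerSeries.constantCoeff (R := K)) ∣ X ^ F.natDegree := by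
      rw [← hmap, ← hGH, Polynomial.map_mul]
      exact dvd_mul_right _ _
    obtain ⟨j, -, hj⟩ := (dvd_prime_pow prime_X _).1 h1
    have h2 : G.map (PowerSeries.constantCoeff (R := K)) = X ^ j :=
      eq_of_monic_of_associated (hG.map _) (monic_X_pow j) hj
    have h3 := congrArg (fun P ↦ coeff P 0) h2
    simp only [coeff_map, coeff_X_pow] at h3
    rcases Nat.eq_zero_or_pos j with rfl | hjpos
    · rw [← hG.natDegree_map (PowerSeries.constantCoeff (R := K)), h2, pow_zero, natDegree_one]
    · rw [if_neg hjpos.ne] at h3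
      exact absurd h3 h0
  rw [hm.irreducible_iff_natDegree]
  refine ⟨fun h1 ↦ h.not_isUnit ?_, fun G H hG hH hGH ↦ ?_⟩
  · rw [h1, ofPoly, Polynomial.coe_one, map_one]
    exact isUnit_one
  · rcases h.isUnit_or_isUnit (a := ofPoly G) (b := ofPoly H) (by rw [← ofPoly_mul, hGH]) with hu | hu
    · exact Or.inl (key G H hG hGH hu)
    · exact Or.inr (key H G hH (by rw [mul_comm, hGH]) hu)

end Coordinates

/-! ### Maximal contact and the strong triangle inequality for polynomials. -/

section PolynomialModel

variable {K : Type*} [Field K] {F G : (PowerSeries K)[X]}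

theorem normOrder_zero (hm : F.Monic) (hF : Irreducible F) :
    normOrder (0 : AdjoinRoot F) = ⊤ :=
  (normOrder_eq_top_iff hm hF).2 rfl

theorem normOrder_pow (g : AdjoinRoot F) (n : ℕ) :
    normOrder (g ^ n) = n * normOrder g := by
  rw [normOrder, map_pow, PowerSeries.order_pow, nsmul_eq_mul, normOrder]

theorem normOrder_add_of_lt (hm : F.Monic) (hF : Irreducible F) {g h : AdjoinRoot F}
    (hgh : normOrder g < normOrder h) : normOrder (g + h) = normOrder g := by
  refine le_antisymm ?_ ?_
  · by_contra! hlt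
    have h1 := min_le_normOrder_add hm hF (g + h) (-h)
    rw [add_neg_cancel_right, normOrder_neg] at h1
    exact absurd h1 (not_le.2 (lt_min hlt hgh))
  · exact (le_min le_rfl hgh.le).trans (min_le_normOrder_add hm hF g h)

theorem le_normOrder_sum (hm : F.Monic) (hF : Irreducible F) {ι : Type*} (s : Finset ι)
    (g : ι → AdjoinRoot F) {N : ℕ∞} (h : ∀ i ∈ s, N ≤ normOrder (g i)) :
    N ≤ normOrder (∑ i ∈ s, g i) := by
  classical
  induction s using Finset.induction_on with
  | empty => simp [normOrder_zero hm hF]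
  | insert i s hi ih =>
    rw [Finset.sum_insert hi]
    exact (le_min (h _ (Finset.mem_insert_self _ _))
      (ih fun j hj ↦ h _ (Finset.mem_insert_of_mem hj))).trans (min_le_normOrder_add hm hF _ _)

theorem eval_ne_zero_of_irreducible (hF : Irreducible F) (hd : 1 < F.natDegree)
    (a : PowerSeries K) : F.eval a ≠ 0 := by
  intro h
  obtain ⟨q, hq⟩ := dvd_iff_isRoot.2 h
  rcases (hq ▸ hF).isUnit_or_isUnit rfl with hu | hu
  · exact not_isUnit_X_sub_C a hu
  · have hq0 : q.natDegree = 0 := natDegree_eq_zero_of_isUnit hu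
    rw [hq, natDegree_mul (X_sub_C_ne_zero a) hu.ne_zero, natDegree_X_sub_C, hq0] at hd
    omega

theorem mk_X_sub_C_eq (a b : PowerSeries K) :
    AdjoinRoot.mk F (X - C a) =
      AdjoinRoot.mk F (X - C b) + algebraMap (PowerSeries K) (AdjoinRoot F) (b - a) := by
  rw [AdjoinRoot.algebraMap_eq, ← AdjoinRoot.mk_C, ← map_add, C_sub]
  congr 1
  ring

/-- An irreducible distinguished polynomial of degree at least two admits a power series whose
contact with its root is not divisible by its degree. -/
theorem exists_not_dvd_order_eval [IsAlgClosed K] (hm : F.Monic) (hF : Irreducible F)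
    (hd : 1 < F.natDegree) (h0 : (F.natDegree : ℕ∞) ≤ (F.coeff 0).order) :
    ∃ (φ : PowerSeries K) (b : ℕ), PowerSeries.constantCoeff φ = 0 ∧ (F.eval φ).order = b ∧
      ¬ F.natDegree ∣ b := by
  by_contra! H
  set n := F.natDegree with hn
  have hstep : ∀ e : ℕ, ∃ φ : PowerSeries K, PowerSeries.constantCoeff φ = 0 ∧
      ((n * (e + 1) : ℕ) : ℕ∞) ≤ (F.eval φ).order := by
    intro e
    induction e with
    | zero => exact ⟨0, map_zero _, by rw [← coeff_zero_eq_eval_zero]; simpa using h0⟩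
    | succ e ih =>
      obtain ⟨φ, hφ, hle⟩ := ih
      have key : ∃ ψ : PowerSeries K, PowerSeries.constantCoeff ψ = 0 ∧
          ((n * (e + 1) : ℕ) : ℕ∞) < (F.eval ψ).order := by
        -- In case of equality `y - φ` and `x^(e+1)` have the same value, so subtracting a suitable
        -- `c x^(e+1)` raises the value.
        rcases hle.eq_or_lt with heq | hlt
        · obtain ⟨c, -, hc⟩ := exists_normOrder_lt_sub hm hF
            (g := algebraMap _ (AdjoinRoot F) (PowerSeries.X ^ (e + 1)))
            (h := AdjoinRoot.mk F (X - C φ)) (by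
              rw [normOrder_algebraMap hm, normOrder_root_sub hm, PowerSeries.order_X_pow, ← heq]
              push_cast; rfl) (by
              rw [Ne, ← normOrder_eq_top_iff hm hF, normOrder_algebraMap hm,
                PowerSeries.order_X_pow, ← Nat.cast_mul]
              exact ENat.natCast_ne_top _)
          refine ⟨φ + PowerSeries.C c * PowerSeries.X ^ (e + 1), by simp [hφ], ?_⟩
          rw [← map_mul, sub_eq_add_neg, ← map_neg, normOrder_algebraMap hm,
            PowerSeries.order_X_pow] at hc
          rw [← normOrder_root_sub hm, mk_X_sub_C_eq _ φ]
          convert hc using 4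
          · push_cast; rfl
          · ring
        · exact ⟨φ, hφ, hlt⟩
      obtain ⟨ψ, hψ, hlt⟩ := key
      refine ⟨ψ, hψ, ?_⟩
      have hb := PowerSeries.coe_toNat_order (eval_ne_zero_of_irreducible hF hd ψ)
      -- Being a multiple of `n` above `n(e+1)`, the new value is at least `n(e+2)`.
      obtain ⟨t, ht⟩ := H ψ _ hψ hb.symm
      rw [← hb, ht] at hlt ⊢
      norm_cast at hlt ⊢
      exact Nat.mul_le_mul_left n (Nat.lt_of_mul_lt_mul_left hlt)
  choose φ hφ0 hφ using hstep
  have hagree : ∀ e e' : ℕ, e ≤ e' → ((e + 1 : ℕ) : ℕ∞) ≤ (φ e - φ e').order := by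
    intro e e' hee
    have h1 := min_le_normOrder_add hm hF (AdjoinRoot.mk F (X - C (φ e')))
      (-AdjoinRoot.mk F (X - C (φ e)))
    rw [mk_X_sub_C_eq _ (φ e), add_comm (AdjoinRoot.mk F (X - C (φ e))), add_neg_cancel_right,
      normOrder_neg, normOrder_algebraMap hm, add_comm, ← mk_X_sub_C_eq,
      normOrder_root_sub hm, normOrder_root_sub hm] at h1
    have h2 : ((n * (e + 1) : ℕ) : ℕ∞) ≤ n * (φ e - φ e').order := by
      refine le_trans (le_min (le_trans ?_ (hφ e')) (hφ e)) h1
      exact_mod_cast Nat.mul_le_mul_left n (Nat.succ_le_succ hee)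
    rw [Nat.cast_mul] at h2
    exact (ENat.mul_le_mul_left_iff (by exact_mod_cast (by omega : n ≠ 0))
      (ENat.natCast_ne_top _)).1 h2
  -- Diagonal limit: by `hagree`, the coefficient of index `i` no longer changes from `φ i` on.
  let ψ : PowerSeries K := PowerSeries.mk fun i ↦ PowerSeries.coeff i (φ i)
  have hψ : ∀ e : ℕ, ((e + 1 : ℕ) : ℕ∞) ≤ (φ e - ψ).order := by
    intro e
    refine PowerSeries.nat_le_order _ _ fun i hi ↦ ?_
    rw [map_sub, PowerSeries.coeff_mk, ← map_sub, ← neg_sub, map_neg, neg_eq_zero]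
    exact PowerSeries.coeff_of_lt_order _
      (lt_of_lt_of_le (by exact_mod_cast Nat.lt_succ_self i) (hagree i e (by omega)))
  have hbig : ∀ e : ℕ, ((n * (e + 1) : ℕ) : ℕ∞) ≤ (F.eval ψ).order := by
    intro e
    rw [← normOrder_root_sub hm, mk_X_sub_C_eq _ (φ e)]
    refine le_trans (le_min ?_ ?_) (min_le_normOrder_add hm hF _ _)
    · rw [normOrder_root_sub hm]
      exact hφ e
    · rw [normOrder_algebraMap hm, Nat.cast_mul]
      exact mul_le_mul' le_rfl (hψ e)
  have hb := PowerSeries.coe_toNat_order (eval_ne_zero_of_irreducible hF hd ψ)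
  -- `F(ψ)` is nonzero, yet its order `N` would be at least `n(N+1)`.
  have h3 := hbig (F.eval ψ).order.toNat
  generalize (F.eval ψ).order.toNat = N at hb h3
  rw [← hb, Nat.cast_le] at h3
  nlinarith

/-- Elements of value smaller than a value `b` not divisible by the degree, attained by a power
series, have value divisible by the degree. -/
theorem natDegree_dvd_of_normOrder_lt (hm : F.Monic) (hF : Irreducible F) {φ : PowerSeries K}
    {k : ℕ} {s : AdjoinRoot F} (hs : normOrder s = k) (hk : (k : ℕ∞) < (F.eval φ).order) :
    F.natDegree ∣ k := by
  obtain ⟨P, rfl⟩ := AdjoinRoot.mk_surjective s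
  -- In `P = P(φ) + (y - φ)Q` the last term has value above `k`, so `k` is the value of `P(φ) ∈
  -- K⟦x⟧`, a multiple of the degree.
  obtain ⟨Q, hQ⟩ := X_sub_C_dvd_sub_C_eval (p := P) (a := φ)
  have h1 : normOrder (AdjoinRoot.mk F P) <
      normOrder (-AdjoinRoot.mk F ((X - C φ) * Q)) := by
    rw [normOrder_neg, map_mul, normOrder_mul, normOrder_root_sub hm, hs]
    exact hk.trans_le le_self_add
  have h2 := normOrder_add_of_lt hm hF h1
  rw [← map_neg, ← map_add, ← hQ, neg_sub, add_sub_cancel, AdjoinRoot.mk_C,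
    ← AdjoinRoot.algebraMap_eq, normOrder_algebraMap hm, hs] at h2
  rcases eq_or_ne (P.eval φ) 0 with h3 | h3
  · rw [h3, PowerSeries.order_zero, ENat.mul_top (by
      exact_mod_cast (hm.natDegree_pos_of_not_isUnit hF.not_isUnit).ne')] at h2
    exact absurd h2 (ENat.top_ne_natCast _)
  · rw [← PowerSeries.coe_toNat_order h3] at h2
    exact ⟨_, by exact_mod_cast h2.symm⟩

theorem monic_taylor (hm : G.Monic) (φ : PowerSeries K) : (taylor φ G).Monic := by
  rw [Monic, leadingCoeff_taylor, hm.leadingCoeff]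

theorem irreducible_taylor (hG : Irreducible G) (φ : PowerSeries K) :
    Irreducible (taylor φ G) := by
  exact (MulEquiv.irreducible_iff (taylorEquiv φ)).2 hG

/-- The Newton polygon of `G(φ + T)` is a single segment, which bounds the order of its coefficient
of index `j`; the factor `(y - φ)^j` has value `j · ord F(φ)`. Multiplication by `deg G` clears
denominators, leaving a weighted sum of the two quantities to be compared. -/
theorem le_normOrder_taylor_term (hm : F.Monic) (hGm : G.Monic) (hG : Irreducible G)
    (φ : PowerSeries K) {j : ℕ} (hj : j ≤ G.natDegree) :
    (G.natDegree - j : ℕ) * (F.natDegree * (G.eval φ).order) +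
      j * (G.natDegree * (F.eval φ).order) ≤
    G.natDegree * normOrder (AdjoinRoot.mk F (C ((taylor φ G).coeff j) * (X - C φ) ^ j)) := by
  have h := natDegree_mul_order_coeff_ge (monic_taylor hGm φ) (irreducible_taylor hG φ) (j := j)
    (by rwa [natDegree_taylor])
  rw [natDegree_taylor, taylor_coeff_zero] at h
  rw [map_mul, map_pow, normOrder_mul, normOrder_pow, normOrder_root_sub hm, AdjoinRoot.mk_C,
    ← AdjoinRoot.algebraMap_eq, normOrder_algebraMap hm, mul_add]
  refine add_le_add ?_ (le_of_eq (by ring))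
  calc _ = (F.natDegree : ℕ∞) * ((G.natDegree - j : ℕ) * (G.eval φ).order) := by ring
    _ ≤ (F.natDegree : ℕ∞) * (G.natDegree * ((taylor φ G).coeff j).order) := by gcongr
    _ = _ := by ring

theorem mk_eq_sum_taylor (φ : PowerSeries K) : AdjoinRoot.mk F G =
    ∑ j ∈ Finset.range (G.natDegree + 1),
      AdjoinRoot.mk F (C ((taylor φ G).coeff j) * (X - C φ) ^ j) := by
  conv_lhs => rw [← sum_taylor_eq G φ]
  rw [sum_over_range _ (by simp), natDegree_taylor, map_sum]

/-- Strong triangle inequality, first form. -/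
theorem min_le_normOrder_mk (hm : F.Monic) (hF : Irreducible F) (hGm : G.Monic)
    (hG : Irreducible G) (hGd : 0 < G.natDegree) (φ : PowerSeries K) :
    min (G.natDegree * (F.eval φ).order) (F.natDegree * (G.eval φ).order) ≤
      normOrder (AdjoinRoot.mk F G) := by
  rw [mk_eq_sum_taylor φ]
  refine le_normOrder_sum hm hF _ _ fun j hj ↦ ?_
  have hj : j ≤ G.natDegree := Nat.lt_succ_iff.1 (Finset.mem_range.1 hj)
  have h := le_normOrder_taylor_term hm hGm hG φ hj
  rw [← ENat.mul_le_mul_left_iff (a := G.natDegree) (by exact_mod_cast hGd.ne')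
    (ENat.natCast_ne_top _)]
  refine le_trans ?_ h
  set M := min (G.natDegree * (F.eval φ).order) (F.natDegree * (G.eval φ).order)
  calc (G.natDegree : ℕ∞) * M = ((G.natDegree - j : ℕ) + (j : ℕ) : ℕ∞) * M := by
        rw [← Nat.cast_add, Nat.sub_add_cancel hj]
    _ = (G.natDegree - j : ℕ) * M + j * M := add_mul _ _ _
    _ ≤ _ := by
      gcongr
      · exact min_le_right _ _
      · exact min_le_left _ _

/-- Strong triangle inequality, second form. -/
theorem normOrder_mk_of_lt (hm : F.Monic) (hF : Irreducible F) (hGm : G.Monic)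
    (hG : Irreducible G) (φ : PowerSeries K)
    (hlt : F.natDegree * (G.eval φ).order < G.natDegree * (F.eval φ).order) :
    normOrder (AdjoinRoot.mk F G) = F.natDegree * (G.eval φ).order := by
  -- The term `j = 0` is `G(φ)`, with exactly the claimed value. Every other term has positive
  -- weight on the larger quantity, so its value is strictly larger.
  rw [mk_eq_sum_taylor φ, Finset.sum_range_succ']
  have h0 : normOrder (AdjoinRoot.mk F (C ((taylor φ G).coeff 0) * (X - C φ) ^ 0)) =
      F.natDegree * (G.eval φ).order := by
    rw [pow_zero, mul_one, AdjoinRoot.mk_C, ← AdjoinRoot.algebraMap_eq, normOrder_algebraMap hm,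
      taylor_coeff_zero]
  rw [add_comm, ← h0]
  refine normOrder_add_of_lt hm hF ?_
  rw [h0]
  obtain ⟨N, hN⟩ := ENat.ne_top_iff_exists.1 hlt.ne_top
  rw [← hN] at hlt ⊢
  refine lt_of_lt_of_le (b := ((N + 1 : ℕ) : ℕ∞)) (by exact_mod_cast Nat.lt_succ_self N) ?_
  refine le_normOrder_sum hm hF _ _ fun j hj ↦ ?_
  have hj : j + 1 ≤ G.natDegree := Finset.mem_range.1 hj
  have h := le_normOrder_taylor_term hm hGm hG φ hj
  rw [← hN] at h
  have hlt' : ((N + 1 : ℕ) : ℕ∞) ≤ G.natDegree * (F.eval φ).order := by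
    rw [Nat.cast_add, Nat.cast_one]
    exact Order.add_one_le_of_lt hlt
  by_contra! hc
  obtain ⟨T, hT⟩ := ENat.ne_top_iff_exists.1 hc.ne_top
  rw [← hT] at h hc
  have h2 : ((G.natDegree - (j + 1) : ℕ) : ℕ∞) * N + (j + 1 : ℕ) * (N + 1 : ℕ) ≤
      G.natDegree * T := le_trans (by gcongr) h
  norm_cast at h2 hc
  obtain ⟨r, hr⟩ := Nat.exists_eq_add_of_le hj
  rw [hr, Nat.add_sub_cancel_left] at h2
  have : T ≤ N := by omega
  nlinarith [Nat.mul_le_mul_left (j + 1 + r) this]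

end PolynomialModel

/-! ### Branches transverse to the line `x = 0`. -/

section Transverse

variable {K : Type*} [Field K] {f g w : PS K} {n m : ℕ}

theorem intersectionNumber_comm (f g : PS K) : intersectionNumber f g = intersectionNumber g f := by
  rw [intersectionNumber, intersectionNumber, Set.pair_comm]

theorem irreducible_of_order_eq_one (hw : w.order = 1) : Irreducible w := by
  have h0 : MvPowerSeries.constantCoeff w = 0 :=
    MvPowerSeries.order_ne_zero_iff_constCoeff_eq_zero.1 (by rw [hw]; exact one_ne_zero)
  refine ⟨fun h ↦ ?_, fun a b hab ↦ ?_⟩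
  · rw [MvPowerSeries.isUnit_iff_constantCoeff, h0] at h
    exact not_isUnit_zero h
  · by_contra! hu
    have h1 : ∀ p : PS K, ¬ IsUnit p → 1 ≤ p.order := by
      intro p hp
      rw [MvPowerSeries.isUnit_iff_constantCoeff, isUnit_iff_ne_zero, not_not] at hp
      exact MvPowerSeries.one_le_order_iff_constCoeff_eq_zero.2 hp
    have h2 := (add_le_add (h1 a hu.1) (h1 b hu.2)).trans MvPowerSeries.le_order_mul
    rw [← hab, hw] at h2
    exact absurd h2 (by decide)

/-- A transverse branch is given by an irreducible polynomial and its intersection numbers are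
orders of norms. -/
theorem exists_polynomial_model (hf : Irreducible f) (ht : IsTransverse f) (hn : f.order = n) :
    ∃ F : (PowerSeries K)[X], F.Monic ∧ Irreducible F ∧ F.natDegree = n ∧
      (∀ i, (n : ℕ∞) ≤ i + (F.coeff i).order) ∧
      F.IsDistinguishedAt (IsLocalRing.maximalIdeal (PowerSeries K)) ∧ Associated (ofPoly F) f ∧
      ∃ θ : PS K →ₐ[K] AdjoinRoot F, Function.Surjective θ ∧ (∀ g, θ g = 0 ↔ f ∣ g) ∧
        (∀ G, θ (ofPoly G) = AdjoinRoot.mk F G) ∧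
        ∀ g, intersectionNumber f g = normOrder (θ g) := by
  obtain ⟨F, u, hu, hfu, hd, hdeg, hc⟩ := ht.exists_weierstrass hn
  have hass : Associated (ofPoly F) f := ⟨hu.unit, hfu.symm⟩
  have hF := irreducible_of_irreducible_ofPoly hd (hass.irreducible_iff.2 hf)
  obtain ⟨θ, hθs, hθk, hθp⟩ := exists_algHom_adjoinRoot hd
  have hk : ∀ g, θ g = 0 ↔ f ∣ g := fun g ↦ (hθk g).trans hass.dvd_iff_dvd_left
  exact ⟨F, hd.monic, hF, hdeg, hc, hd, hass, θ, hθs, hk, hθp,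
    intersectionNumber_eq_of_surjective hd.monic hF θ hθs hk⟩

/-- A smooth transverse curve is a graph over the line `y = 0`. -/
theorem exists_associated_X_sub_C (hw : w.order = 1) (ht : IsTransverse w) :
    ∃ φ : PowerSeries K, PowerSeries.constantCoeff φ = 0 ∧ Associated (ofPoly (X - C φ)) w := by
  obtain ⟨W, u, hu, hwu, hd, hdeg, -⟩ := ht.exists_weierstrass (n := 1) (by exact_mod_cast hw)
  have hW := hd.monic.eq_X_add_C hdeg
  refine ⟨-W.coeff 0, ?_, hu.unit, ?_⟩
  · rw [map_neg, neg_eq_zero]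
    exact mem_maximalIdeal_iff.1 (hd.mem (by omega))
  · rw [C_neg, sub_neg_eq_add, ← hW]
    exact hwu.symm

theorem constantCoeff_ofPoly (G : (PowerSeries K)[X]) :
    MvPowerSeries.constantCoeff (ofPoly G) = PowerSeries.constantCoeff (G.coeff 0) := by
  have := coeff_ofPoly G 0 0
  rwa [Finsupp.single_zero, Finsupp.single_zero, add_zero,
    MvPowerSeries.coeff_zero_eq_constantCoeff_apply,
    PowerSeries.coeff_zero_eq_constantCoeff_apply] at this

theorem order_ofPoly_X_sub_C {φ : PowerSeries K} (hφ : PowerSeries.constantCoeff φ = 0) :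
    (ofPoly (X - C φ)).order = 1 := by
  refine le_antisymm ?_ ?_
  · have h := coeff_ofPoly (X - C φ) 1 0
    rw [Finsupp.single_zero, add_zero] at h
    have h1 := MvPowerSeries.order_le (f := ofPoly (X - C φ)) (d := Finsupp.single 0 1) (by
      rw [h]
      simp [coeff_X])
    rw [Finsupp.degree_single] at h1
    exact_mod_cast h1
  · rw [MvPowerSeries.one_le_order_iff_constCoeff_eq_zero, constantCoeff_ofPoly]
    simp [hφ]

/-- Every power series is `y h(y, x) + a(x)`. -/
theorem exists_eq_ofPoly_X_mul_add (g : PS K) : ∃ (h : PS K) (a : PowerSeries K),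
    g = ofPoly X * h + ofPoly (C a) ∧
    MvPowerSeries.constantCoeff h = MvPowerSeries.coeff (Finsupp.single 0 1) g ∧
    ∀ j, PowerSeries.coeff j a = MvPowerSeries.coeff (Finsupp.single 1 j) g := by
  refine ⟨(iterEquiv K).symm
    (PowerSeries.mk fun p ↦ PowerSeries.coeff (p + 1) (iterEquiv K g)),
    PowerSeries.constantCoeff (iterEquiv K g), ?_, ?_, ?_⟩
  · apply (iterEquiv K).injective
    rw [map_add, map_mul, ofPoly, ofPoly, AlgEquiv.apply_symm_apply, AlgEquiv.apply_symm_apply,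
      AlgEquiv.apply_symm_apply, Polynomial.coe_X, Polynomial.coe_C]
    exact PowerSeries.eq_X_mul_shift_add_const _
  · have h1 := coeff_coeff_iterEquiv ((iterEquiv K).symm
      (PowerSeries.mk fun p ↦ PowerSeries.coeff (p + 1) (iterEquiv K g))) 0 0
    rw [Finsupp.single_zero, Finsupp.single_zero, add_zero,
      MvPowerSeries.coeff_zero_eq_constantCoeff_apply] at h1
    rw [← h1, AlgEquiv.apply_symm_apply, PowerSeries.coeff_mk, coeff_coeff_iterEquiv,
      Finsupp.single_zero, add_zero]
  · intro j
    rw [← PowerSeries.coeff_zero_eq_constantCoeff_apply, coeff_coeff_iterEquiv,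
      Finsupp.single_zero, zero_add]

theorem intersectionNumber_mul_of_transverse (hf : Irreducible f) (ht : IsTransverse f)
    (g h : PS K) :
    intersectionNumber f (g * h) = intersectionNumber f g + intersectionNumber f h := by
  obtain ⟨F, hm, hF, -, -, -, -, θ, -, -, -, hι⟩ := exists_polynomial_model hf ht
    ht.choose_spec.1
  rw [hι, hι, hι, map_mul, normOrder_mul]

theorem intersectionNumber_eq_top_iff_of_transverse (hf : Irreducible f) (ht : IsTransverse f) :
    intersectionNumber f g = ⊤ ↔ f ∣ g := by
  obtain ⟨F, hm, hF, -, -, -, -, θ, -, hk, -, hι⟩ := exists_polynomial_model hf ht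
    ht.choose_spec.1
  rw [hι, normOrder_eq_top_iff hm hF, hk]

theorem intersectionNumber_eq_of_associated {h : PS K} (hgh : Associated g h) (f : PS K) :
    intersectionNumber f g = intersectionNumber f h := by
  have : Ideal.span ({f, g} : Set (PS K)) = Ideal.span {f, h} := by
    rw [Ideal.span_insert, Ideal.span_insert, le_antisymm
      (Ideal.span_singleton_le_span_singleton.2 hgh.symm.dvd)
      (Ideal.span_singleton_le_span_singleton.2 hgh.dvd)]
  rw [intersectionNumber, intersectionNumber, this]

/-- `x` has value `n` and `y` has value `ord F(0) ≥ n`; these generate the maximal ideal. -/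
theorem le_intersectionNumber_of_transverse (hf : Irreducible f) (ht : IsTransverse f)
    (hn : f.order = n) (hg : MvPowerSeries.constantCoeff g = 0) :
    (n : ℕ∞) ≤ intersectionNumber f g := by
  obtain ⟨F, hm, hF, hdeg, hc, -, -, θ, -, -, hp, hι⟩ := exists_polynomial_model hf ht hn
  obtain ⟨h, a, hga, -, ha⟩ := exists_eq_ofPoly_X_mul_add g
  rw [hι, hga, map_add, map_mul, hp, hp, AdjoinRoot.mk_C, ← AdjoinRoot.algebraMap_eq]
  refine le_trans (le_min ?_ ?_) (min_le_normOrder_add hm hF _ _)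
  · have h0 := normOrder_root_sub hm 0
    rw [C_0, sub_zero, ← coeff_zero_eq_eval_zero] at h0
    rw [normOrder_mul, h0]
    have := hc 0
    rw [Nat.cast_zero, zero_add] at this
    exact this.trans le_self_add
  · rw [normOrder_algebraMap hm, hdeg]
    refine le_mul_of_one_le_right' ?_
    rw [PowerSeries.one_le_order_iff_constCoeff_eq_zero,
      ← PowerSeries.coeff_zero_eq_constantCoeff_apply, ha, Finsupp.single_zero]
    exact hg

theorem exists_intersectionNumber_eq_of_transverse (hf : Irreducible f) (ht : IsTransverse f)
    (hn : f.order = n) : ∃ g, intersectionNumber f g = n := by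
  obtain ⟨F, hm, hF, hdeg, hc, -, -, θ, -, -, hp, hι⟩ := exists_polynomial_model hf ht hn
  refine ⟨ofPoly (C PowerSeries.X), ?_⟩
  rw [hι, hp, AdjoinRoot.mk_C, ← AdjoinRoot.algebraMap_eq, normOrder_algebraMap hm, hdeg,
    PowerSeries.order_X, mul_one]

/-- The maximal contact of a transverse singular branch with smooth curves. -/
theorem exists_maximal_contact_of_transverse [IsAlgClosed K] (hf : Irreducible f)
    (ht : IsTransverse f) (hn : f.order = n) (hn1 : 1 < n) :
    ∃ b : ℕ, ¬ n ∣ b ∧ (∃ w : PS K, w.order = 1 ∧ intersectionNumber f w = b) ∧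
      (∀ (g : PS K) (k : ℕ), intersectionNumber f g = k → k < b → n ∣ k) ∧
      ∀ w : PS K, w.order = 1 → intersectionNumber f w ≤ b := by
  have hle := fun g ↦ le_intersectionNumber_of_transverse (g := g) hf ht hn
  obtain ⟨F, hm, hF, hdeg, hc, -, -, θ, -, -, hp, hι⟩ := exists_polynomial_model hf ht hn
  subst hdeg
  obtain ⟨φ, b, hφ, hb, hndvd⟩ := exists_not_dvd_order_eval hm hF hn1 (by simpa using hc 0)
  have hbw : intersectionNumber f (ofPoly (X - C φ)) = b := by
    rw [hι, hp, normOrder_root_sub hm, hb]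
  have hnb : F.natDegree < b := by
    have h1 := hle (ofPoly (X - C φ)) (by rw [constantCoeff_ofPoly]; simp [hφ])
    rw [hbw, Nat.cast_le] at h1
    exact lt_of_le_of_ne h1 fun h ↦ hndvd (h ▸ dvd_rfl)
  refine ⟨b, hndvd, ⟨_, order_ofPoly_X_sub_C hφ, hbw⟩, fun g k hg hk ↦ ?_, fun w hw ↦ ?_⟩
  · rw [hι] at hg
    exact natDegree_dvd_of_normOrder_lt hm hF hg (by rw [hb]; exact_mod_cast hk)
  -- If `w` has no linear term in `y`, then `w = y h + a(x)` with `ord a = 1` and `h` a non-unit; `y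
  -- h` has value at least `2n`, so `w` has value `n < b`. Otherwise `w` is a graph `y = ψ`; a value
  -- above `b` would force `b = n · ord(ψ - φ)`.
  · by_cases hwt : MvPowerSeries.coeff (Finsupp.single 0 1) w = 0
    · obtain ⟨h, a, hga, hh, ha⟩ := exists_eq_ofPoly_X_mul_add w
      have h0 : MvPowerSeries.constantCoeff w = 0 :=
        MvPowerSeries.order_ne_zero_iff_constCoeff_eq_zero.1 (by rw [hw]; exact one_ne_zero)
      have ha1 : a.order = 1 := by
        rw [← Nat.cast_one, PowerSeries.order_eq_nat]
        refine ⟨fun h1 ↦ ?_, fun i hi ↦ ?_⟩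
        · rw [ha] at h1
          obtain ⟨⟨d, hd, hd1⟩, -⟩ :=
            MvPowerSeries.order_eq_nat.1 (by exact_mod_cast hw : w.order = (1 : ℕ))
          rw [finsupp_fin_two_eq d] at hd hd1
          rw [map_add, Finsupp.degree_single, Finsupp.degree_single] at hd1
          rcases Nat.eq_zero_or_pos (d 0) with h2 | h2
          · rw [h2, show d 1 = 1 by omega, Finsupp.single_zero, zero_add] at hd
            exact hd h1
          · rw [show d 0 = 1 by omega, show d 1 = 0 by omega, Finsupp.single_zero, add_zero] at hd
            exact hd hwt
        · rw [ha, Nat.lt_one_iff.1 hi, Finsupp.single_zero]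
          exact h0
      have h1 : normOrder (algebraMap _ (AdjoinRoot F) a) = F.natDegree := by
        rw [normOrder_algebraMap hm, ha1, mul_one]
      have h2 : normOrder (algebraMap _ (AdjoinRoot F) a) < normOrder (θ (ofPoly X * h)) := by
        rw [h1, map_mul, normOrder_mul, ← hι, ← hι]
        have h3 := hle (ofPoly X) (by rw [constantCoeff_ofPoly]; simp)
        have h4 := hle h (by rw [hh, hwt])
        refine lt_of_lt_of_le ?_ (add_le_add h3 h4)
        exact_mod_cast (by omega : F.natDegree < F.natDegree + F.natDegree)
      rw [hι, hga, map_add, hp, AdjoinRoot.mk_C, ← AdjoinRoot.algebraMap_eq, add_comm,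
        normOrder_add_of_lt hm hF h2, h1]
      exact_mod_cast hnb.le
    · obtain ⟨ψ, -, hψ⟩ := exists_associated_X_sub_C hw ⟨1, by exact_mod_cast hw, hwt⟩
      rw [← intersectionNumber_eq_of_associated hψ, hι, hp, normOrder_root_sub hm]
      by_contra! hlt
      have h1 : (F.eval φ).order < (F.eval ψ).order := by rwa [hb]
      rw [← normOrder_root_sub hm, ← normOrder_root_sub hm,
        ← normOrder_neg (AdjoinRoot.mk F (X - C ψ))] at h1
      have h2 := normOrder_add_of_lt hm hF h1
      rw [mk_X_sub_C_eq φ ψ, add_right_comm, add_neg_cancel, zero_add,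
        normOrder_algebraMap hm, ← mk_X_sub_C_eq, normOrder_root_sub hm, hb] at h2
      rcases eq_or_ne (ψ - φ) 0 with h3 | h3
      · rw [h3, PowerSeries.order_zero, ENat.mul_top (by exact_mod_cast (by omega))] at h2
        exact ENat.top_ne_natCast _ h2
      · rw [← PowerSeries.coe_toNat_order h3] at h2
        exact hndvd ⟨_, by exact_mod_cast h2.symm⟩

theorem strong_triangle_of_transverse (hf : Irreducible f) (ht : IsTransverse f)
    (hn : f.order = n) (hg : Irreducible g) (hgt : IsTransverse g) (hm : g.order = m)
    (hw : w.order = 1) (hwt : IsTransverse w) :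
    min (m * intersectionNumber f w) (n * intersectionNumber g w) ≤ intersectionNumber f g ∧
      (n * intersectionNumber g w < m * intersectionNumber f w →
        intersectionNumber f g = n * intersectionNumber g w) := by
  obtain ⟨φ, -, hφ⟩ := exists_associated_X_sub_C hw hwt
  obtain ⟨F, hFm, hF, hFd, -, -, -, θ, -, -, hp, hι⟩ := exists_polynomial_model hf ht hn
  obtain ⟨G, hGm, hG, hGd, -, -, hGa, θ', -, -, hp', hι'⟩ := exists_polynomial_model hg hgt hm
  rw [← intersectionNumber_eq_of_associated hφ f, ← intersectionNumber_eq_of_associated hφ g,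
    ← intersectionNumber_eq_of_associated hGa f, hι, hι, hι', hp, hp, hp',
    normOrder_root_sub hFm, normOrder_root_sub hGm, ← hFd, ← hGd]
  exact ⟨min_le_normOrder_mk hFm hF hGm hG (hGm.natDegree_pos_of_not_isUnit hG.not_isUnit) φ,
    normOrder_mk_of_lt hFm hF hGm hG φ⟩

end Transverse

/-! ### Shears that make curves transverse. -/

section Shear

variable {K : Type*} [Field K]

/-- The images of the variables under a shear. -/
noncomputable def shearVars (c : K) : Fin 2 → PS K :=
  ![MvPowerSeries.X 0, MvPowerSeries.X 1 + MvPowerSeries.C c * MvPowerSeries.X 0]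

theorem hasSubst_shearVars (c : K) : MvPowerSeries.HasSubst (shearVars c) := by
  refine MvPowerSeries.hasSubst_of_constantCoeff_zero fun i ↦ ?_
  fin_cases i <;> simp [shearVars]

theorem subst_shearVars_subst (c d : K) (h : c + d = 0) (f : PS K) :
    MvPowerSeries.subst (shearVars d) (MvPowerSeries.subst (shearVars c) f) = f := by
  rw [MvPowerSeries.subst_comp_subst_apply (hasSubst_shearVars c) (hasSubst_shearVars d)]
  have : (fun s ↦ MvPowerSeries.subst (shearVars d) (shearVars c s)) = MvPowerSeries.X := by
    funext i
    have hX := MvPowerSeries.subst_X (R := K) (hasSubst_shearVars d)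
    fin_cases i
    · exact hX 0
    · have h1 : shearVars c 1 = MvPowerSeries.X 1 + c • MvPowerSeries.X 0 := by
        simp [shearVars, MvPowerSeries.smul_eq_C_mul]
      change MvPowerSeries.subst (shearVars d) (shearVars c 1) = _
      rw [h1, MvPowerSeries.subst_add (hasSubst_shearVars d),
        MvPowerSeries.subst_smul (hasSubst_shearVars d), hX, hX]
      simp only [shearVars, Matrix.cons_val_one, Matrix.cons_val_zero,
        MvPowerSeries.smul_eq_C_mul, Matrix.cons_val_fin_one]
      rw [add_assoc, ← add_mul, ← map_add, add_comm d c, h]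
      simp
  rw [this, MvPowerSeries.subst_self, id]

/-- The automorphism `x ↦ x + c y` of the ring of power series. -/
noncomputable def shear (c : K) : PS K ≃ₐ[K] PS K :=
  AlgEquiv.ofAlgHom (MvPowerSeries.substAlgHom (hasSubst_shearVars c))
    (MvPowerSeries.substAlgHom (hasSubst_shearVars (-c)))
    (AlgHom.ext fun f ↦ by
      simp only [AlgHom.comp_apply, MvPowerSeries.substAlgHom_apply]
      exact subst_shearVars_subst _ _ (neg_add_cancel c) f)
    (AlgHom.ext fun f ↦ by
      simp only [AlgHom.comp_apply, MvPowerSeries.substAlgHom_apply]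
      exact subst_shearVars_subst _ _ (add_neg_cancel c) f)

theorem shear_apply (c : K) (f : PS K) : shear c f = MvPowerSeries.subst (shearVars c) f :=
  MvPowerSeries.substAlgHom_apply (hasSubst_shearVars c) f

theorem order_le_order_shear (c : K) (f : PS K) : f.order ≤ (shear c f).order := by
  rw [shear_apply]
  refine le_trans ?_ (MvPowerSeries.le_order_subst (hasSubst_shearVars c) f)
  refine le_mul_of_one_le_left' (le_iInf fun i ↦ ?_)
  rw [MvPowerSeries.one_le_order_iff_constCoeff_eq_zero]
  fin_cases i <;> simp [shearVars]

theorem shear_symm (c : K) : (shear c).symm = shear (-c) := by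
  ext1 f
  rw [AlgEquiv.symm_apply_eq, shear_apply, shear_apply,
    subst_shearVars_subst _ _ (neg_add_cancel c)]

theorem order_shear (c : K) (f : PS K) : (shear c f).order = f.order := by
  refine le_antisymm ?_ (order_le_order_shear c f)
  conv_rhs => rw [← (shear c).symm_apply_apply f, shear_symm]
  exact order_le_order_shear _ _

theorem constantCoeff_shear (c : K) {g : PS K} (hg : MvPowerSeries.constantCoeff g = 0) :
    MvPowerSeries.constantCoeff (shear c g) = 0 := by
  rwa [← MvPowerSeries.one_le_order_iff_constCoeff_eq_zero, order_shear,
    MvPowerSeries.one_le_order_iff_constCoeff_eq_zero]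

/-- Restriction of a power series to the line `x = 0`. -/
noncomputable def restrictLine (K : Type*) [Field K] : PS K →+* PowerSeries K :=
  (PowerSeries.map (PowerSeries.constantCoeff (R := K))).comp
    (iterEquiv K : PS K →+* PowerSeries (PowerSeries K))

theorem coeff_restrictLine (f : PS K) (n : ℕ) :
    PowerSeries.coeff n (restrictLine K f) = MvPowerSeries.coeff (Finsupp.single 0 n) f := by
  change PowerSeries.coeff n
    (PowerSeries.map (PowerSeries.constantCoeff (R := K)) (iterEquiv K f)) = _
  rw [PowerSeries.coeff_map, ← PowerSeries.coeff_zero_eq_constantCoeff_apply,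
    coeff_coeff_iterEquiv, Finsupp.single_zero, add_zero]

/-- On the line `x = 0` the shear sends `y` to `y` and `x` to `c y`, so every monomial restricts to
a multiple of a power of `y`. -/
theorem coeff_prod_shearVars (c : K) (n : ℕ) (d : Fin 2 →₀ ℕ) :
    MvPowerSeries.coeff (Finsupp.single 0 n) (d.prod fun s e ↦ shearVars c s ^ e) =
      if d 0 + d 1 = n then c ^ d 1 else 0 := by
  have h0 : restrictLine K (MvPowerSeries.X 0) = PowerSeries.X := by
    ext i
    rw [coeff_restrictLine, MvPowerSeries.coeff_X, PowerSeries.coeff_X]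
    congr 1
    simp [(Finsupp.single_injective (0 : Fin 2)).eq_iff]
  have h1 : restrictLine K (MvPowerSeries.X 1) = 0 := by
    ext i
    rw [coeff_restrictLine, MvPowerSeries.coeff_X, map_zero, if_neg]
    intro h
    simpa using DFunLike.congr_fun h 1
  have hC : restrictLine K (MvPowerSeries.C c) = PowerSeries.C c := by
    ext i
    rw [coeff_restrictLine, MvPowerSeries.coeff_C, PowerSeries.coeff_C]
    simp
  rw [← coeff_restrictLine, Finsupp.prod_fintype _ _ (by simp), Fin.prod_univ_two, map_mul,
    map_pow, map_pow]
  simp only [shearVars, Matrix.cons_val_one, Matrix.cons_val_zero, Matrix.cons_val_fin_one,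
    map_add, map_mul, h0, h1, hC, zero_add]
  rw [mul_pow, mul_left_comm, ← pow_add, ← map_pow, PowerSeries.coeff_C_mul,
    PowerSeries.coeff_X_pow]
  simp [eq_comm]

/-- The homogeneous component of degree `n` of `f`, restricted to the line `y = 1`. -/
noncomputable def homogeneousPoly (f : PS K) (n : ℕ) : K[X] :=
  ∑ i ∈ Finset.range (n + 1),
    C (MvPowerSeries.coeff (Finsupp.single 0 (n - i) + Finsupp.single 1 i) f) * X ^ i

theorem coeff_shear (c : K) (f : PS K) (n : ℕ) :
    MvPowerSeries.coeff (Finsupp.single 0 n) (shear c f) = (homogeneousPoly f n).eval c := by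
  rw [shear_apply, MvPowerSeries.coeff_subst (hasSubst_shearVars c)]
  simp only [coeff_prod_shearVars, homogeneousPoly, eval_finsetSum, eval_mul, eval_C, eval_pow,
    eval_X]
  rw [finsum_eq_sum_of_support_subset (s := (Finset.range (n + 1)).image fun i ↦
    (Finsupp.single 0 (n - i) + Finsupp.single 1 i : Fin 2 →₀ ℕ))]
  · rw [Finset.sum_image]
    · refine Finset.sum_congr rfl fun i hi ↦ ?_
      have : i ≤ n := Nat.lt_succ_iff.1 (Finset.mem_range.1 hi)
      simp [this]
    · intro i _ j _ h
      simpa using DFunLike.congr_fun h 1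
  · intro d hd
    rw [Function.mem_support] at hd
    have h : d 0 + d 1 = n := by
      by_contra h
      simp [h] at hd
    rw [Finset.coe_image]
    refine ⟨d 1, by simp; omega, ?_⟩
    conv_rhs => rw [finsupp_fin_two_eq d]
    simp only [← h, Nat.add_sub_cancel]

theorem homogeneousPoly_ne_zero {f : PS K} {n : ℕ} (hn : f.order = n) :
    homogeneousPoly f n ≠ 0 := by
  intro h
  obtain ⟨⟨d, hd, hdn⟩, -⟩ := MvPowerSeries.order_eq_nat.1 hn
  rw [finsupp_fin_two_eq d] at hd hdn
  rw [map_add, Finsupp.degree_single, Finsupp.degree_single] at hdn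
  have h1 := congrArg (fun P ↦ coeff P (d 1)) h
  simp only [homogeneousPoly, finsetSum_coeff, coeff_C_mul, coeff_X_pow, coeff_zero] at h1
  rw [Finset.sum_eq_single (d 1) (fun i _ hi ↦ by simp [hi.symm])
    (fun hi ↦ absurd (Finset.mem_range.2 (by omega)) hi), if_pos rfl, mul_one,
    show n - d 1 = d 0 by omega] at h1
  exact hd h1

/-- Finitely many curves become transverse after a generic shear. -/
theorem exists_shear_transverse [Infinite K] (s : Finset (PS K)) (hs : ∀ f ∈ s, f ≠ 0) :
    ∃ c : K, ∀ f ∈ s, IsTransverse (shear c f) := by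
  have hord : ∀ f ∈ s, f.order = (f.order.toNat : ℕ) := fun f hf ↦
    (MvPowerSeries.ne_zero_iff_order_finite.1 (hs f hf)).symm
  have hne : ∏ f ∈ s, homogeneousPoly f f.order.toNat ≠ 0 :=
    Finset.prod_ne_zero_iff.2 fun f hf ↦ homogeneousPoly_ne_zero (hord f hf)
  -- The slopes to avoid are the roots of one nonzero polynomial over an infinite field.
  obtain ⟨c, hc⟩ : ∃ c, (∏ f ∈ s, homogeneousPoly f f.order.toNat).eval c ≠ 0 := by
    by_contra! h
    exact hne (Polynomial.funext (by simpa using h))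
  refine ⟨c, fun f hf ↦ ⟨_, (order_shear c f).trans (hord f hf), ?_⟩⟩
  rw [coeff_shear]
  rw [eval_prod, Finset.prod_ne_zero_iff] at hc
  exact hc f hf

theorem intersectionNumber_algEquiv (σ : PS K ≃ₐ[K] PS K) (f g : PS K) :
    intersectionNumber (σ f) (σ g) = intersectionNumber f g := by
  rw [intersectionNumber, intersectionNumber]
  congr 1
  refine (LinearEquiv.rank_eq (Ideal.quotientEquivAlg (Ideal.span {f, g})
    (Ideal.span {σ f, σ g}) σ ?_).toLinearEquiv).symm
  rw [Ideal.map_span, Set.image_pair]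
  rfl

end Shear

/-! ### Arbitrary branches, by transport along a shear. -/

section Branch

variable {K : Type*} [Field K] [IsAlgClosed K] {f g w : PS K} {n m : ℕ}

theorem exists_shear_of_irreducible (hf : Irreducible f) :
    ∃ c : K, Irreducible (shear c f) ∧ IsTransverse (shear c f) := by
  have : Infinite K := IsAlgClosed.instInfinite
  obtain ⟨c, hc⟩ := exists_shear_transverse {f} (by simpa using hf.ne_zero)
  exact ⟨c, (MulEquiv.irreducible_iff (shear c)).2 hf, hc f (by simp)⟩

theorem intersectionNumber_mul (hf : Irreducible f) (g h : PS K) :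
    intersectionNumber f (g * h) = intersectionNumber f g + intersectionNumber f h := by
  obtain ⟨c, hi, ht⟩ := exists_shear_of_irreducible hf
  rw [← intersectionNumber_algEquiv (shear c), map_mul,
    intersectionNumber_mul_of_transverse hi ht, intersectionNumber_algEquiv,
    intersectionNumber_algEquiv]

theorem intersectionNumber_eq_top_iff (hf : Irreducible f) :
    intersectionNumber f g = ⊤ ↔ f ∣ g := by
  obtain ⟨c, hi, ht⟩ := exists_shear_of_irreducible hf
  rw [← intersectionNumber_algEquiv (shear c),
    intersectionNumber_eq_top_iff_of_transverse hi ht, map_dvd_iff]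

theorem le_intersectionNumber (hf : Irreducible f) (hn : f.order = n)
    (hg : MvPowerSeries.constantCoeff g = 0) : (n : ℕ∞) ≤ intersectionNumber f g := by
  obtain ⟨c, hi, ht⟩ := exists_shear_of_irreducible hf
  rw [← intersectionNumber_algEquiv (shear c)]
  exact le_intersectionNumber_of_transverse hi ht ((order_shear c f).trans hn)
    (constantCoeff_shear c hg)

theorem exists_intersectionNumber_eq (hf : Irreducible f) (hn : f.order = n) :
    ∃ g, intersectionNumber f g = n := by
  obtain ⟨c, hi, ht⟩ := exists_shear_of_irreducible hf
  obtain ⟨g, hg⟩ := exists_intersectionNumber_eq_of_transverse hi ht ((order_shear c f).trans hn)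
  refine ⟨(shear c).symm g, ?_⟩
  rw [← intersectionNumber_algEquiv (shear c), AlgEquiv.apply_symm_apply, hg]

/-- The maximal contact of a singular branch with smooth curves. -/
theorem exists_maximal_contact (hf : Irreducible f) (hn : f.order = n) (hn1 : 1 < n) :
    ∃ b : ℕ, ¬ n ∣ b ∧ (∃ w : PS K, w.order = 1 ∧ intersectionNumber f w = b) ∧
      (∀ (g : PS K) (k : ℕ), intersectionNumber f g = k → k < b → n ∣ k) ∧
      ∀ w : PS K, w.order = 1 → intersectionNumber f w ≤ b := by
  obtain ⟨c, hi, ht⟩ := exists_shear_of_irreducible hf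
  obtain ⟨b, hb, ⟨w, hw, hwb⟩, h1, h2⟩ :=
    exists_maximal_contact_of_transverse hi ht ((order_shear c f).trans hn) hn1
  refine ⟨b, hb, ⟨(shear c).symm w, ?_, ?_⟩, fun g k hg ↦ h1 (shear c g) k ?_, fun w hw ↦ ?_⟩
  · rw [← order_shear c, AlgEquiv.apply_symm_apply, hw]
  · rw [← intersectionNumber_algEquiv (shear c), AlgEquiv.apply_symm_apply, hwb]
  · rw [intersectionNumber_algEquiv, hg]
  · rw [← intersectionNumber_algEquiv (shear c)]
    exact h2 _ ((order_shear c w).trans hw)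

/-- The strong triangle inequality for two branches and a smooth curve. -/
theorem strong_triangle (hf : Irreducible f) (hn : f.order = n) (hg : Irreducible g)
    (hm : g.order = m) (hw : w.order = 1) :
    min (m * intersectionNumber f w) (n * intersectionNumber g w) ≤ intersectionNumber f g ∧
      (n * intersectionNumber g w < m * intersectionNumber f w →
        intersectionNumber f g = n * intersectionNumber g w) := by
  classical
  have : Infinite K := IsAlgClosed.instInfinite
  obtain ⟨c, hc⟩ := exists_shear_transverse {f, g, w} (by
    simp [hf.ne_zero, hg.ne_zero, (irreducible_of_order_eq_one hw).ne_zero])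
  have := strong_triangle_of_transverse ((MulEquiv.irreducible_iff (shear c)).2 hf)
    (hc f (by simp)) ((order_shear c f).trans hn) ((MulEquiv.irreducible_iff (shear c)).2 hg)
    (hc g (by simp)) ((order_shear c g).trans hm) ((order_shear c w).trans hw) (hc w (by simp))
  simpa only [intersectionNumber_algEquiv] using this

end Branch

/-! ### Minimal generators of subsets of `ℕ`. -/

section MinimalGenerators

/-- The sequence of successive minimal generators of a set of natural numbers. -/
noncomputable def generatorSeq (S : Set ℕ) : ℕ → ℕ
  | k => sInf (S \ (AddSubmonoid.closure (Set.range fun i : Fin k ↦ generatorSeq S i) : Set ℕ))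
  decreasing_by exact i.2

/-- The submonoid generated by the first `k` terms of the generator sequence. -/
noncomputable def generatedSubmonoid (S : Set ℕ) (k : ℕ) : AddSubmonoid ℕ :=
  AddSubmonoid.closure (Set.range fun i : Fin k ↦ generatorSeq S i)

variable {S : AddSubmonoid ℕ}

theorem generatorSeq_eq (S : Set ℕ) (k : ℕ) :
    generatorSeq S k = sInf (S \ (generatedSubmonoid S k : Set ℕ)) := by
  rw [generatorSeq, generatedSubmonoid]

theorem generatorSeq_mem_generatedSubmonoid (S : Set ℕ) {i k : ℕ} (h : i < k) :
    generatorSeq S i ∈ generatedSubmonoid S k :=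
  AddSubmonoid.subset_closure ⟨⟨i, h⟩, rfl⟩

theorem generatedSubmonoid_mono (S : Set ℕ) : Monotone (generatedSubmonoid S) := by
  intro i j hij
  refine AddSubmonoid.closure_mono ?_
  rintro _ ⟨a, rfl⟩
  exact ⟨⟨a, a.2.trans_le hij⟩, rfl⟩

theorem isLeast_generatorSeq {S : Set ℕ} {k : ℕ} (h : ¬ S ⊆ generatedSubmonoid S k) :
    IsLeast (S \ (generatedSubmonoid S k : Set ℕ)) (generatorSeq S k) := by
  rw [generatorSeq_eq]
  exact ⟨Nat.sInf_mem (Set.sdiff_nonempty.2 h), fun _ hx ↦ Nat.sInf_le hx⟩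

theorem generatedSubmonoid_zero (S : Set ℕ) : (generatedSubmonoid S 0 : Set ℕ) = {0} := by
  simp [generatedSubmonoid]

/-- If the process never ended, the generators would be pairwise incongruent modulo the first one: a
later one congruent to an earlier one would already be generated. There are only finitely many
residue classes. -/
theorem exists_subset_generatedSubmonoid (S : Set ℕ) :
    ∃ k, S ⊆ generatedSubmonoid S k := by
  by_contra! H
  have hl := fun k ↦ isLeast_generatorSeq (H k)
  have h0 : generatorSeq S 0 ≠ 0 := by
    have := (hl 0).1.2
    rwa [generatedSubmonoid_zero] at this
  set n := generatorSeq S 0 with hn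
  have hn0 : 0 < n := Nat.pos_of_ne_zero h0
  have key : ∀ i j, i < j → generatorSeq S i % n ≠ generatorSeq S j % n := by
    intro i j hij hmod
    have hle : generatorSeq S i ≤ generatorSeq S j :=
      (hl i).2 ⟨(hl j).1.1, fun h ↦ (hl j).1.2 (generatedSubmonoid_mono S hij.le h)⟩
    obtain ⟨t, ht⟩ := (Nat.modEq_iff_dvd' hle).1 hmod
    refine (hl j).1.2 ?_
    rw [show generatorSeq S j = generatorSeq S i + t • n by
      rw [smul_eq_mul, mul_comm]; omega]
    exact add_mem (generatorSeq_mem_generatedSubmonoid S hij)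
      (nsmul_mem (generatorSeq_mem_generatedSubmonoid S (by omega)) t)
  obtain ⟨i, j, hij, h⟩ := Finite.exists_ne_map_eq_of_infinite
    fun k : ℕ ↦ (⟨generatorSeq S k % n, Nat.mod_lt _ hn0⟩ : Fin n)
  simp only [Fin.mk.injEq] at h
  rcases lt_or_gt_of_ne hij with hij | hij
  · exact key i j hij h
  · exact key j i hij h.symm

theorem image_setOf_lt_eq_range (V : ℕ → ℕ) {N : ℕ} (i : Fin N) :
    (fun j : Fin N ↦ V j) '' {j | j < i} = Set.range fun j : Fin (i : ℕ) ↦ V j := by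
  ext x
  constructor
  · rintro ⟨j, hj, rfl⟩
    exact ⟨⟨j, hj⟩, rfl⟩
  · rintro ⟨j, rfl⟩
    exact ⟨⟨j, j.2.trans i.2⟩, j.2, rfl⟩

/-- A submonoid of `ℕ` that is not generated by its least nonzero element has a minimal system of
generators with at least two elements. -/
theorem exists_isMinimalGenerators {n b : ℕ} (hn : IsLeast ((S : Set ℕ) \ {0}) n) (hb : b ∈ S)
    (hbn : ¬ n ∣ b) : ∃ (k : ℕ) (v : Fin (k + 2) → ℕ), IsMinimalGenerators (S : Set ℕ) v := by
  classical
  have hex := exists_subset_generatedSubmonoid (S : Set ℕ)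
  set N := Nat.find hex with hN
  have hsub : (S : Set ℕ) ⊆ generatedSubmonoid (S : Set ℕ) N := Nat.find_spec hex
  -- Before stage `N` the difference set is nonempty, so these terms are true minima rather than the
  -- default `sInf ∅ = 0`.
  have hl : ∀ i < N, IsLeast ((S : Set ℕ) \ (generatedSubmonoid (S : Set ℕ) i : Set ℕ))
      (generatorSeq S i) := fun i hi ↦ isLeast_generatorSeq (Nat.find_min hex hi)
  have h0 : N ≠ 0 := by
    intro h
    rw [h, generatedSubmonoid_zero] at hsub
    exact hn.1.2 (hsub hn.1.1)
  have hv0 := hl 0 (Nat.pos_of_ne_zero h0)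
  rw [generatedSubmonoid_zero] at hv0
  have h1 : N ≠ 1 := by
    intro h
    have hb' := hsub hb
    rw [h, generatedSubmonoid, SetLike.mem_coe, Set.range_unique,
      AddSubmonoid.mem_closure_singleton] at hb'
    obtain ⟨t, ht⟩ := hb'
    refine hbn ⟨t, ?_⟩
    rw [← ht, smul_eq_mul, mul_comm, hn.unique hv0]
    rfl
  obtain ⟨k, hk⟩ : ∃ k, N = k + 2 := ⟨N - 2, by omega⟩
  refine ⟨k, fun i ↦ generatorSeq S i, hv0, fun i _ ↦ ?_, ?_⟩
  · rw [image_setOf_lt_eq_range]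
    exact hl i (by omega)
  · refine subset_antisymm (hk ▸ hsub) ?_
    rw [SetLike.coe_subset_coe, AddSubmonoid.closure_le]
    rintro _ ⟨i, rfl⟩
    exact (hl i (by omega)).1.1

end MinimalGenerators

/-! ### The semigroup of a branch. -/

section Semigroup

variable {K : Type*} [Field K] [IsAlgClosed K] {f g w : PS K} {n m : ℕ}

/-- A finite intersection number already forces `f ∤ g`. -/
theorem mem_semigroup_iff (hf : Irreducible f) {k : ℕ} :
    k ∈ semigroup f ↔ ∃ g, intersectionNumber f g = k := by
  refine ⟨fun ⟨g, _, h⟩ ↦ ⟨g, h⟩, fun ⟨g, h⟩ ↦ ⟨g, fun hd ↦ ?_, h⟩⟩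
  rw [(intersectionNumber_eq_top_iff hf).2 hd] at h
  exact ENat.top_ne_natCast _ h

omit [IsAlgClosed K] in
theorem intersectionNumber_of_isUnit (f : PS K) (hg : IsUnit g) : intersectionNumber f g = 0 := by
  have h : Ideal.span ({f, g} : Set (PS K)) = ⊤ :=
    Ideal.eq_top_of_isUnit_mem _ (Ideal.subset_span (by simp)) hg
  have : Subsingleton (PS K ⧸ Ideal.span ({f, g} : Set (PS K))) :=
    Ideal.Quotient.subsingleton_iff.2 h
  rw [intersectionNumber, rank_subsingleton', map_zero]

/-- The semigroup of a branch as a submonoid of `ℕ`. -/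
def semigroupSubmonoid (hf : Irreducible f) : AddSubmonoid ℕ where
  carrier := semigroup f
  zero_mem' := (mem_semigroup_iff hf).2 ⟨1, by
    rw [intersectionNumber_of_isUnit f isUnit_one, Nat.cast_zero]⟩
  add_mem' := by
    intro a b ha hb
    rw [mem_semigroup_iff hf] at *
    obtain ⟨g, hg⟩ := ha
    obtain ⟨h, hh⟩ := hb
    exact ⟨g * h, by rw [intersectionNumber_mul hf, hg, hh, Nat.cast_add]⟩

omit [IsAlgClosed K] in
theorem exists_order_eq (hf : Irreducible f) : ∃ n : ℕ, f.order = n ∧ 0 < n := by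
  refine ⟨f.order.toNat, (MvPowerSeries.ne_zero_iff_order_finite.1 hf.ne_zero).symm, ?_⟩
  by_contra! h
  have h1 := MvPowerSeries.ne_zero_iff_order_finite.1 hf.ne_zero
  rw [Nat.le_zero.1 h, Nat.cast_zero, eq_comm] at h1
  have h2 : ¬ MvPowerSeries.constantCoeff f = 0 := fun h3 ↦
    MvPowerSeries.order_ne_zero_iff_constCoeff_eq_zero.2 h3 h1
  exact hf.not_isUnit (MvPowerSeries.isUnit_iff_constantCoeff.2 (isUnit_iff_ne_zero.2 h2))

/-- The multiplicity of a branch is the least nonzero element of its semigroup. -/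
theorem isLeast_semigroup (hf : Irreducible f) (hn : f.order = n) :
    IsLeast (semigroup f \ {0}) n := by
  obtain ⟨n', hn', hpos⟩ := exists_order_eq hf
  obtain rfl : n' = n := by rw [hn] at hn'; exact_mod_cast hn'.symm
  refine ⟨⟨(mem_semigroup_iff hf).2 (exists_intersectionNumber_eq hf hn), hpos.ne'⟩, ?_⟩
  rintro k ⟨hk, hk0⟩
  obtain ⟨g, hg⟩ := (mem_semigroup_iff hf).1 hk
  have hg0 : MvPowerSeries.constantCoeff g = 0 := by
    by_contra h
    rw [intersectionNumber_of_isUnit f (MvPowerSeries.isUnit_iff_constantCoeff.2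
      (isUnit_iff_ne_zero.2 h))] at hg
    exact hk0 (by exact_mod_cast hg.symm)
  have := le_intersectionNumber hf hn hg0
  rw [hg] at this
  exact_mod_cast this

theorem coe_closure_singleton_nat (n : ℕ) :
    (AddSubmonoid.closure {n} : Set ℕ) = {k | n ∣ k} := by
  ext k
  rw [SetLike.mem_coe, AddSubmonoid.mem_closure_singleton]
  exact ⟨fun ⟨t, ht⟩ ↦ ⟨t, by rw [← ht, smul_eq_mul, mul_comm]⟩,
    fun ⟨t, ht⟩ ↦ ⟨t, by rw [ht, smul_eq_mul, mul_comm]⟩⟩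

/-- The maximal contact of a singular branch with smooth curves is the least element of its
semigroup that is not divisible by the multiplicity. -/
theorem exists_isLeast_maximal_contact (hf : Irreducible f) (hn : f.order = n) (hn1 : 1 < n) :
    ∃ b : ℕ, IsLeast (semigroup f \ {k | n ∣ k}) b ∧
      (∃ w : PS K, w.order = 1 ∧ intersectionNumber f w = b) ∧
      ∀ w : PS K, w.order = 1 → intersectionNumber f w ≤ b := by
  obtain ⟨b, hb, ⟨w, hw, hwb⟩, h1, h2⟩ := exists_maximal_contact hf hn hn1
  refine ⟨b, ⟨⟨(mem_semigroup_iff hf).2 ⟨w, hwb⟩, hb⟩, ?_⟩, ⟨w, hw, hwb⟩, h2⟩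
  rintro k ⟨hk, hkn⟩
  obtain ⟨g, hg⟩ := (mem_semigroup_iff hf).1 hk
  by_contra! hlt
  exact hkn (h1 g k hg hlt)

end Semigroup

/-! ### Contact exponents of branches and of curves. -/

section Contact

variable {K : Type*} [Field K] {f g p q w : PS K} {n m : ℕ}

theorem order_eq_of_associated (h : Associated p q) : p.order = q.order := by
  have key : ∀ {p q : PS K}, p ∣ q → p.order ≤ q.order := by
    rintro p _ ⟨u, rfl⟩
    exact le_self_add.trans MvPowerSeries.le_order_mul
  exact le_antisymm (key h.dvd) (key h.symm.dvd)

theorem branchContact_eq_of_associated {p' q' : PS K} (hp : Associated p p')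
    (hq : Associated q q') : branchContact p q = branchContact p' q' := by
  rw [branchContact, branchContact, multiplicity, multiplicity, multiplicity, multiplicity,
    order_eq_of_associated hp, order_eq_of_associated hq, intersectionNumber_eq_of_associated hq,
    intersectionNumber_comm, intersectionNumber_eq_of_associated hp, intersectionNumber_comm]

theorem isSmoothBranch_iff : IsSmoothBranch w ↔ w.order = 1 :=
  ⟨fun h ↦ h.2, fun h ↦ ⟨irreducible_of_order_eq_one h, h⟩⟩

theorem irreducible_iff_prime_powerSeries : Irreducible p ↔ Prime p := by
  rw [← MulEquiv.irreducible_iff (iterEquiv K), ← MulEquiv.prime_iff (iterEquiv K)]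
  exact UniqueFactorizationMonoid.irreducible_iff_prime

/-- By unique factorization each irreducible factor of the product is associated to some `F i`, and
contact ignores units. -/
theorem contact_prod {r : ℕ} {F : Fin r → PS K} (hF : ∀ i, Irreducible (F i))
    (hw : Irreducible w) : contact (∏ i, F i) w = ⨅ i, branchContact (F i) w := by
  refine le_antisymm (le_iInf fun i ↦ ?_) ?_
  · exact iInf₂_le_of_le (F i) ⟨hF i, Finset.dvd_prod_of_mem F (Finset.mem_univ i)⟩
      (iInf₂_le w ⟨hw, dvd_rfl⟩)
  · refine le_iInf₂ fun p hp ↦ le_iInf₂ fun q hq ↦ ?_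
    obtain ⟨i, -, hi⟩ := (irreducible_iff_prime_powerSeries.1 hp.1).exists_mem_finset_dvd hp.2
    refine (iInf_le _ i).trans (le_of_eq (branchContact_eq_of_associated ?_ ?_))
    · exact (hp.1.associated_of_dvd (hF i) hi).symm
    · exact (hq.1.associated_of_dvd hw hq.2).symm

theorem contact_eq_branchContact (hf : Irreducible f) (hw : Irreducible w) :
    contact f w = branchContact f w := by
  have := contact_prod (r := 1) (F := fun _ ↦ f) (fun _ ↦ hf) hw
  simpa using this

variable [IsAlgClosed K]

theorem contactExponent_eq_top_of_order_eq_one (hf : f.order = 1) : contactExponent f = ⊤ := by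
  have hi := irreducible_of_order_eq_one hf
  refine top_le_iff.1 (le_iSup₂_of_le f (isSmoothBranch_iff.2 hf) ?_)
  rw [contact_eq_branchContact hi hi, branchContact, (intersectionNumber_eq_top_iff hi).2 dvd_rfl,
    multiplicity, hf]
  simp

omit [IsAlgClosed K] in
theorem branchContact_eq_div (hn : f.order = n) (hm : g.order = m) :
    branchContact f g = (intersectionNumber f g : ℝ≥0∞) / ((n : ℝ≥0∞) * m) := by
  rw [branchContact, multiplicity, multiplicity, hn, hm, ENat.toENNReal_coe,
    ENat.toENNReal_coe]

omit [IsAlgClosed K] in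
theorem branchContact_of_order_eq_one (hn : f.order = n) (hw : w.order = 1) :
    branchContact f w = (intersectionNumber f w : ℝ≥0∞) / n := by
  rw [branchContact_eq_div hn (m := 1) (by exact_mod_cast hw), Nat.cast_one, mul_one]

omit [IsAlgClosed K] in
theorem contactExponent_eq_iSup (hf : Irreducible f) :
    contactExponent f = ⨆ (w : PS K) (_ : w.order = 1), branchContact f w := by
  refine iSup_congr fun w ↦ iSup_congr_Prop isSmoothBranch_iff fun hw ↦ ?_
  exact contact_eq_branchContact hf (irreducible_of_order_eq_one hw)

theorem contactExponent_eq_div (hf : Irreducible f) (hn : f.order = n) (hn1 : 1 < n) {b : ℕ}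
    (hb : IsLeast (semigroup f \ {k | n ∣ k}) b) :
    contactExponent f = (b : ℝ≥0∞) / n := by
  obtain ⟨b', hb', ⟨w, hw, hwb⟩, hle⟩ := exists_isLeast_maximal_contact hf hn hn1
  obtain rfl := hb.unique hb'
  rw [contactExponent_eq_iSup hf]
  refine le_antisymm (iSup₂_le fun w hw ↦ ?_) (le_iSup₂_of_le w hw ?_)
  · rw [branchContact_of_order_eq_one hn hw]
    gcongr
    exact_mod_cast ENat.toENNReal_le.2 (hle w hw)
  · rw [branchContact_of_order_eq_one hn hw, hwb, ENat.toENNReal_coe]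

/-- The contact exponent of a branch is attained. -/
theorem exists_branchContact_eq_contactExponent (hf : Irreducible f) :
    ∃ w : PS K, w.order = 1 ∧ branchContact f w = contactExponent f := by
  obtain ⟨n, hn, hpos⟩ := exists_order_eq hf
  rcases (Nat.succ_le_of_lt hpos).eq_or_lt with h1 | h1
  · have hf1 : f.order = 1 := by rw [hn, ← h1]; rfl
    refine ⟨f, hf1, ?_⟩
    rw [contactExponent_eq_top_of_order_eq_one hf1, branchContact_of_order_eq_one hn hf1,
      (intersectionNumber_eq_top_iff hf).2 dvd_rfl, ENat.toENNReal_top,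
      ENNReal.top_div_of_ne_top (ENNReal.natCast_ne_top n)]
  · obtain ⟨b, hb, ⟨w, hw, hwb⟩, -⟩ := exists_isLeast_maximal_contact hf hn h1
    refine ⟨w, hw, ?_⟩
    rw [contactExponent_eq_div hf hn h1 hb, branchContact_of_order_eq_one hn hw, hwb,
      ENat.toENNReal_coe]

omit [IsAlgClosed K] in
theorem branchContact_eq_mul_div (hn : f.order = n) (hw : w.order = 1) (hm : 0 < m) :
    branchContact f w = ((m * intersectionNumber f w : ℕ∞) : ℝ≥0∞) / ((n : ℝ≥0∞) * m) := by
  rw [branchContact_of_order_eq_one hn hw, ENat.toENNReal_mul, ENat.toENNReal_coe,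
    mul_comm (n : ℝ≥0∞)]
  exact (ENNReal.mul_div_mul_left _ _ (by exact_mod_cast hm.ne') (ENNReal.natCast_ne_top m)).symm

/-- The strong triangle inequality bounding the contact of two branches by their contacts with a
smooth curve. -/
theorem min_branchContact_le (hf : Irreducible f) (hg : Irreducible g) (hw : w.order = 1) :
    min (branchContact f w) (branchContact g w) ≤ branchContact f g := by
  obtain ⟨n, hn, hn0⟩ := exists_order_eq hf
  obtain ⟨m, hm, hm0⟩ := exists_order_eq hg
  have h := (strong_triangle hf hn hg hm hw).1
  rw [branchContact_eq_mul_div hn hw hm0, branchContact_eq_mul_div hm hw hn0,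
    branchContact_eq_div hn hm, mul_comm (m : ℝ≥0∞)]
  rcases min_le_iff.1 h with h | h
  · exact (min_le_left _ _).trans (ENNReal.div_le_div_right (ENat.toENNReal_le.2 h) _)
  · exact (min_le_right _ _).trans (ENNReal.div_le_div_right (ENat.toENNReal_le.2 h) _)

/-- The strong triangle inequality bounding the contact of a branch with a smooth curve. -/
theorem min_branchContact_le_of_order_eq_one (hf : Irreducible f) (hg : Irreducible g)
    (hw : w.order = 1) :
    min (branchContact f g) (branchContact g w) ≤ branchContact f w := by
  obtain ⟨n, hn, hn0⟩ := exists_order_eq hf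
  obtain ⟨m, hm, hm0⟩ := exists_order_eq hg
  have h := (strong_triangle hg hm hf hn hw).2
  rw [branchContact_eq_mul_div hn hw hm0, branchContact_eq_mul_div hm hw hn0,
    branchContact_eq_div hn hm, mul_comm (m : ℝ≥0∞)]
  -- If `f` has smaller contact with `w` than `g` has, the equality case gives `d(f,g) = d(f,w)`.
  rcases lt_or_ge (m * intersectionNumber f w) (n * intersectionNumber g w) with hlt | hle
  · rw [intersectionNumber_comm f g, h hlt]
    exact min_le_left _ _
  · exact (min_le_right _ _).trans (ENNReal.div_le_div_right (ENat.toENNReal_le.2 hle) _)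

/-- The contact exponent of a curve in terms of its branches. -/
theorem contactExponent_prod {r : ℕ} [NeZero r] {F : Fin r → PS K}
    (hF : ∀ i, Irreducible (F i)) :
    contactExponent (∏ i, F i) =
      min (⨅ i, contactExponent (F i)) (⨅ i, ⨅ j, branchContact (F i) (F j)) := by
  refine le_antisymm (iSup₂_le fun w hw ↦ ?_) ?_
  · rw [isSmoothBranch_iff] at hw
    rw [contact_prod hF (irreducible_of_order_eq_one hw)]
    refine le_min (iInf_mono fun i ↦ ?_) (le_iInf fun i ↦ le_iInf fun j ↦ ?_)
    · rw [contactExponent_eq_iSup (hF i)]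
      exact le_iSup₂_of_le w hw le_rfl
    · exact (le_min (iInf_le _ i) (iInf_le _ j)).trans (min_branchContact_le (hF i) (hF j) hw)
  -- A smooth curve of maximal contact with one branch suffices: `d(F i, w) ≥ min (d(F i, F 0)) (d(F
  -- 0, w))`.
  · obtain ⟨w, hw, hmax⟩ := exists_branchContact_eq_contactExponent (hF 0)
    refine le_iSup₂_of_le w (isSmoothBranch_iff.2 hw) ?_
    rw [contact_prod hF (irreducible_of_order_eq_one hw)]
    refine le_iInf fun i ↦ ?_
    refine (le_min ?_ ?_).trans (min_branchContact_le_of_order_eq_one (hF i) (hF 0) hw)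
    · exact (min_le_right _ _).trans ((iInf_le _ i).trans (iInf_le _ 0))
    · rw [hmax]
      exact (min_le_left _ _).trans (iInf_le _ 0)

theorem order_eq_of_semigroup_eq (hf : Irreducible f) (hg : Irreducible g)
    (h : semigroup f = semigroup g) : f.order = g.order := by
  obtain ⟨n, hn, -⟩ := exists_order_eq hf
  obtain ⟨m, hm, -⟩ := exists_order_eq hg
  have h1 := isLeast_semigroup hf hn
  rw [h] at h1
  rw [hn, hm, h1.unique (isLeast_semigroup hg hm)]

/-- The contact exponent of a branch depends only on its semigroup. -/
theorem contactExponent_eq_of_semigroup_eq (hf : Irreducible f) (hg : Irreducible g)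
    (h : semigroup f = semigroup g) : contactExponent f = contactExponent g := by
  have ho := order_eq_of_semigroup_eq hf hg h
  obtain ⟨n, hn, hpos⟩ := exists_order_eq hf
  rcases (Nat.succ_le_of_lt hpos).eq_or_lt with h1 | h1
  · have hf1 : f.order = 1 := by rw [hn, ← h1]; rfl
    rw [contactExponent_eq_top_of_order_eq_one hf1,
      contactExponent_eq_top_of_order_eq_one (ho ▸ hf1)]
  · obtain ⟨b, hb, -⟩ := exists_isLeast_maximal_contact hf hn h1
    rw [contactExponent_eq_div hf hn h1 hb, contactExponent_eq_div hg (ho ▸ hn) h1 (h ▸ hb)]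

/-- The contact exponent is an equisingularity invariant. -/
theorem Equisingular.contactExponent_eq (hf : IsCurve f) (h : Equisingular f g) :
    contactExponent f = contactExponent g := by
  obtain ⟨r, F, G, hF, hG, rfl, rfl, hs, hι⟩ := h
  -- An empty product would be `1`, which has nonzero constant term.
  have : NeZero r := ⟨by
    rintro rfl
    simpa using hf.2⟩
  have hο := fun i ↦ order_eq_of_semigroup_eq (hF i) (hG i) (hs i)
  rw [contactExponent_prod hF, contactExponent_prod hG]
  congr 1
  · exact iInf_congr fun i ↦ contactExponent_eq_of_semigroup_eq (hF i) (hG i) (hs i)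
  · refine iInf_congr fun i ↦ iInf_congr fun j ↦ ?_
    rw [branchContact, branchContact, multiplicity, multiplicity, multiplicity, multiplicity,
      hο i, hο j, hι i j]

theorem image_setOf_lt_one {k : ℕ} (v : Fin (k + 2) → ℕ) : v '' {i | i < 1} = {v 0} := by
  have : {i : Fin (k + 2) | i < 1} = {0} := by
    ext i
    rw [Set.mem_ofPred_eq, Set.mem_singleton_iff, Fin.lt_one_iff]
  rw [this, Set.image_singleton]

end Contact

end PlaneCurve

theorem mainTheorem3 {K : Type*} [Field K] [IsAlgClosed K] :
    (∀ f g : PlaneCurve.PS K, PlaneCurve.IsReducedCurve f → PlaneCurve.IsReducedCurve g →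
      PlaneCurve.Equisingular f g →
      PlaneCurve.contactExponent f = PlaneCurve.contactExponent g) ∧
    (∀ f : PlaneCurve.PS K, PlaneCurve.IsSingularBranch f →
      (∃ (n : ℕ) (v : Fin (n + 2) → ℕ),
        PlaneCurve.IsMinimalGenerators (PlaneCurve.semigroup f) v) ∧
      ∀ (n : ℕ) (v : Fin (n + 2) → ℕ),
        PlaneCurve.IsMinimalGenerators (PlaneCurve.semigroup f) v →
        PlaneCurve.contactExponent f = (v 1 : ENNReal) / (v 0 : ENNReal)) ∧
    (∀ f : PlaneCurve.PS K, PlaneCurve.IsSmoothBranch f →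
      PlaneCurve.contactExponent f = ⊤) := by
  refine ⟨fun f g hf _ h ↦ h.contactExponent_eq hf.1, fun f ⟨hf, hf1⟩ ↦ ?_,
    fun f hf ↦ PlaneCurve.contactExponent_eq_top_of_order_eq_one hf.2⟩
  obtain ⟨n, hn, -⟩ := PlaneCurve.exists_order_eq hf
  have hn1 : 1 < n := by
    rw [PlaneCurve.multiplicity, hn] at hf1
    exact_mod_cast hf1
  have hleast := PlaneCurve.isLeast_semigroup hf hn
  obtain ⟨b, hb, -⟩ := PlaneCurve.exists_isLeast_maximal_contact hf hn hn1
  refine ⟨PlaneCurve.exists_isMinimalGenerators (S := PlaneCurve.semigroupSubmonoid hf) hleast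
    hb.1.1 hb.1.2, fun k v hv ↦ ?_⟩
  have h0 : n = v 0 := hleast.unique hv.zero
  -- Since `v 0 = n`, this says that `v 1` is the least element of the semigroup not divisible by
  -- `n`, which is the maximal contact.
  have h1 := hv.next 1 (by simp)
  rw [PlaneCurve.image_setOf_lt_one, ← h0, PlaneCurve.coe_closure_singleton_nat] at h1
  rw [← h0, PlaneCurve.contactExponent_eq_div hf hn hn1 h1]
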